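/- **Setting.** Let $E$ be a Dedekind complete Riesz space with weak order unit $e$, and let $E^u$ be its universal completion, in which $E$ is an order dense Riesz subspace. A *conditional expectation* on a Riesz space $F$ is a positive order continuous linear projection $F\to F$ which maps weak order units to weak order units and whose range is a Dedekind complete Riesz subspace; it is *strictly positive* if $T|f|=0$ implies $f=0$. Let $T$ be a strictly positive conditional expectation on $E$. Its natural domain is $L^1(T)=\mathrm{dom}(T)-\mathrm{dom}(T)\subset E^u$, where $f\in\mathrm{dom}(T)$ if $f\in E^u_+$ is the supremum in $E^u$ of an upwards directed subset $D$ of $E_+$ for which $T(D)$ is order bounded in $E^u$. For $x\in E^u_+$ and $p\ge 1$, the power $x^p\in E^u$ is given by the functional calculus with respect to $e$: $x^p=\int_{[0,\infty)}t^p\,dE_t$, where $E_t$ is the component of $e$ in the band generated by $(te-x)^+$. Put $L^p(T)=\{x\in L^1(T): |x|^p\in L^1(T)\}$. A filtration on $L^1(T)$ is a sequence $(T_i)_{i\ge1}$ of conditional expectations on $L^1(T)$ with $T_iT_j=T_jT_i=T_i$ for $i<j$. A submartingale $(X_i,T_i)_{i\ge1}$ in $L^p(T)$ consists of a filtration $(T_i)$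 on $L^1(T)$ and of $X_i\in L^p(T)$ with $X_i\in R(T_i)$ for all $i$ and $T_iX_j\ge X_i$ for $i<j$. A sequence $(x_n)$ in $E^u$ converges to $x$ in order if there is a sequence $v_n\downarrow 0$ in $E^u$ with $|x_n-x|\le v_n$ for all $n$. **Theorem 5.1 (Submartingale convergence).** Let $p\ge 1$ and let $(X_i,T_i)_{i\ge1}$ be a submartingale in $L^p(T)$ with $X_i\ge0$ for all $i$, where $T_1$ is strictly positive and $T_1e=e$. (Both hold if $Te=e$ and $TT_i=T=T_iT$ for all $i$, where $T$ here also denotes its extension to $L^1(T)$.) Let $(a_i)_{i\ge1}$ be a non-decreasing sequence of positive real numbers diverging to $\infty$. If the series $$\sum_{i=1}^\infty T_1\!\left(\frac{X_{i+1}^p-X_i^p}{a_{i+1}^p}\right)$$ converges in order in $E^u$, then $X_n/a_n\to 0$ in order in $E^u$ as $n\to\infty$. -/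

import Mathlib

/-! Riesz spaces, conditional expectations on them, natural domains and `L^p` spaces.

Throughout, a Dedekind complete Riesz space is a real ordered vector space which is a
`ConditionallyCompleteLattice`.  The universal completion `E^u` of `E` is a universally complete
Riesz space `U` which contains `E` as an order dense Riesz subspace. -/

namespace RieszSpace

set_option linter.unusedSectionVars false

variable {U : Type*} [ConditionallyCompleteLattice U] [AddCommGroup U] [IsOrderedAddMonoid U]
  [Module ℝ U] [IsOrderedModule ℝ U]

/-- Lateral completeness: every non-empty set of pairwise disjoint positive elements has a
supremum.  A Dedekind complete Riesz space with this property is universally complete. -/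
def IsLaterallyComplete (U : Type*) [ConditionallyCompleteLattice U] [AddCommGroup U] : Prop :=
  ∀ S : Set U, S.Nonempty → (∀ x ∈ S, 0 ≤ x) → (S.Pairwise fun x y => x ⊓ y = 0) →
    ∃ s, IsLUB S s

/-- `F` is a Riesz subspace of `U` (a linear subspace closed under the lattice operations) which
is Dedekind complete in its own order. -/
structure IsDedekindCompleteRieszSubspace (F : Submodule ℝ U) : Prop where
  sup_mem : ∀ x ∈ F, ∀ y ∈ F, x ⊔ y ∈ F
  inf_mem : ∀ x ∈ F, ∀ y ∈ F, x ⊓ y ∈ F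
  exists_isLUB : ∀ S : Set F, S.Nonempty → BddAbove S → ∃ s : F, IsLUB S s

/-- `U` is the universal completion of its Riesz subspace `E`. -/
structure IsUniversalCompletion (E : Submodule ℝ U) : Prop where
  laterallyComplete : IsLaterallyComplete U
  orderDense : ∀ u : U, 0 < u → ∃ x ∈ E, 0 < x ∧ x ≤ u

/-- `w` is a weak order unit of the Riesz space `F`. -/
def IsWeakOrderUnit (F : Submodule ℝ U) (w : F) : Prop :=
  0 ≤ w ∧ ∀ x : F, 0 ≤ x → (x : U) ⊓ (w : U) = 0 → x = 0

/-- A conditional expectation on the Riesz space `F`: a positive order continuous linear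
projection that maps weak order units to weak order units and whose range is a Dedekind complete
Riesz subspace. -/
structure IsCondExp (F : Submodule ℝ U) (T : F →ₗ[ℝ] F) : Prop where
  positive : ∀ x : F, 0 ≤ x → 0 ≤ T x
  orderContinuous : ∀ D : Set F, D.Nonempty → DirectedOn (· ≥ ·) D → IsGLB D 0 →
    IsGLB (T '' D) 0
  projection : ∀ x : F, T (T x) = T x
  map_weakOrderUnit : ∀ w : F, IsWeakOrderUnit F w → IsWeakOrderUnit F (T w)
  range_complete : IsDedekindCompleteRieszSubspace ((LinearMap.range T).map F.subtype)

/-- Strict positivity of a positive operator on a Riesz space: `T|f| = 0` only for `f = 0`, that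
is, no element `f ≥ 0` other than `0` is mapped to `0`. -/
def IsStrictlyPositiveOp (F : Submodule ℝ U) (T : F →ₗ[ℝ] F) : Prop :=
  ∀ f : F, 0 ≤ f → T f = 0 → f = 0

/-- A filtration on `F`: conditional expectations with `T i T j = T j T i = T i` for `i < j`. -/
structure IsFiltration (F : Submodule ℝ U) (T : ℕ → F →ₗ[ℝ] F) : Prop where
  condExp : ∀ i, IsCondExp F (T i)
  comp_left : ∀ i j, i < j → T i ∘ₗ T j = T i
  comp_right : ∀ i j, i < j → T j ∘ₗ T i = T i

/-- `(X i, T i)` is a submartingale: `X` is adapted to the filtration `T` and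
`T i (X j) ≥ X i` for `i < j`. -/
structure IsSubmartingale (F : Submodule ℝ U) (T : ℕ → F →ₗ[ℝ] F) (X : ℕ → F) : Prop where
  filtration : IsFiltration F T
  adapted : ∀ i, X i ∈ LinearMap.range (T i)
  le_map : ∀ i j, i < j → X i ≤ T i (X j)

/-- The order convergence of a sequence: `|x n - l| ≤ v n ↓ 0` for some sequence `v`. -/
def OrderTendsto (x : ℕ → U) (l : U) : Prop :=
  ∃ v : ℕ → U, Antitone v ∧ IsGLB (Set.range v) 0 ∧ ∀ n, |x n - l| ≤ v n

/-- `P_g f` for `f, g ≥ 0`: the component of `f` in the band generated by `g`. -/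
noncomputable def bandComponent (g f : U) : U := ⨆ n : ℕ, f ⊓ ((n : ℝ) • g)

/-- The spectral system of `x` with respect to the unit `e`: the component of `e` in the band
generated by `(te - x)⁺`. -/
noncomputable def spectralSystem (e x : U) (t : ℝ) : U := bandComponent ((t • e - x)⁺) e

/-- The lower Riemann-Stieltjes sums of `∫ f(t) dE_t` over `[0, ∞)`, for a non-decreasing
`f ≥ 0` on `[0, ∞)`, where `E_t` is the spectral system of `x` with respect to `e`. -/
def lowerSpectralSums (f : ℝ → ℝ) (e x : U) : Set U :=
  {s | ∃ (n : ℕ) (t : ℕ → ℝ), 0 ≤ t 0 ∧ Monotone t ∧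
    s = ∑ i ∈ Finset.range n, f (t i) • (spectralSystem e x (t (i + 1)) - spectralSystem e x (t i))}

/-- The power `x ^ p` of `x ≥ 0` by the functional calculus with respect to the unit `e`, that is
`∫ t ^ p dE_t`, with `E_t` the spectral system of `x`. -/
noncomputable def rieszPow (e : U) (p : ℝ) (x : U) : U :=
  sSup (lowerSpectralSums (fun t => t ^ p) e x)

/-- The cone `dom(T)` in `E^u`: the suprema `f` in `E^u` of upwards directed subsets `D` of the
positive cone of `E` for which `T(D)` is order bounded in `E^u`. -/
def naturalDomCone (E : Submodule ℝ U) (T : E →ₗ[ℝ] E) : Set U :=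
  {f | ∃ D : Set E, D.Nonempty ∧ DirectedOn (· ≤ ·) D ∧ (∀ d ∈ D, 0 ≤ d) ∧
    IsLUB ((fun d : E => (d : U)) '' D) f ∧ BddAbove ((fun d : E => (T d : U)) '' D)}

theorem zero_mem_naturalDomCone (E : Submodule ℝ U) (T : E →ₗ[ℝ] E) :
    (0 : U) ∈ naturalDomCone E T := by
  refine ⟨{0}, by simp, by simp [DirectedOn], by simp, by simp, by simp⟩

theorem add_mem_naturalDomCone (E : Submodule ℝ U) (T : E →ₗ[ℝ] E) {f g : U}
    (hf : f ∈ naturalDomCone E T) (hg : g ∈ naturalDomCone E T) :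
    f + g ∈ naturalDomCone E T := by
  obtain ⟨D, hD, dD, pD, lD, ⟨b, bD⟩⟩ := hf
  obtain ⟨D', hD', dD', pD', lD', ⟨b', bD'⟩⟩ := hg
  refine ⟨Set.image2 (· + ·) D D', hD.image2 hD', ?_, ?_, ?_, ?_⟩
  · rintro _ ⟨x, hx, y, hy, rfl⟩ _ ⟨x', hx', y', hy', rfl⟩
    obtain ⟨z, hz, h1, h2⟩ := dD x hx x' hx'
    obtain ⟨w, hw, h3, h4⟩ := dD' y hy y' hy'
    exact ⟨z + w, ⟨z, hz, w, hw, rfl⟩, add_le_add h1 h3, add_le_add h2 h4⟩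
  · rintro _ ⟨x, hx, y, hy, rfl⟩
    exact add_nonneg (pD x hx) (pD' y hy)
  · constructor
    · rintro _ ⟨_, ⟨x, hx, y, hy, rfl⟩, rfl⟩
      exact add_le_add (lD.1 ⟨x, hx, rfl⟩) (lD'.1 ⟨y, hy, rfl⟩)
    · intro u hu
      have h1 : f ≤ u - g := lD.2 (by
        rintro _ ⟨x, hx, rfl⟩
        have h2 : g ≤ u - (x : U) := lD'.2 (by
          rintro _ ⟨y, hy, rfl⟩
          have h3 : ((x + y : E) : U) ≤ u := hu ⟨x + y, ⟨x, hx, y, hy, rfl⟩, rfl⟩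
          exact le_sub_iff_add_le'.2 (by simpa using h3))
        exact le_sub_comm.1 h2)
      exact le_sub_iff_add_le.1 h1
  · refine ⟨b + b', ?_⟩
    rintro _ ⟨_, ⟨x, hx, y, hy, rfl⟩, rfl⟩
    have := add_le_add (bD ⟨x, hx, rfl⟩) (bD' ⟨y, hy, rfl⟩)
    simpa using this

theorem smul_mem_naturalDomCone (E : Submodule ℝ U) (T : E →ₗ[ℝ] E) {c : ℝ} (hc : 0 ≤ c) {f : U}
    (hf : f ∈ naturalDomCone E T) : c • f ∈ naturalDomCone E T := by
  rcases hc.eq_or_lt with rfl | hc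
  · simpa using zero_mem_naturalDomCone E T
  obtain ⟨D, hD, dD, pD, lD, ⟨b, bD⟩⟩ := hf
  refine ⟨(fun d => c • d) '' D, hD.image _, ?_, ?_, ?_, ?_⟩
  · rintro _ ⟨x, hx, rfl⟩ _ ⟨x', hx', rfl⟩
    obtain ⟨z, hz, h1, h2⟩ := dD x hx x' hx'
    refine ⟨c • z, ⟨z, hz, rfl⟩, ?_, ?_⟩
    · exact (smul_le_smul_of_nonneg_left (show (x : U) ≤ z from h1) hc.le : c • (x : U) ≤ c • (z : U))
    · exact (smul_le_smul_of_nonneg_left (show (x' : U) ≤ z from h2) hc.le : c • (x' : U) ≤ c • (z : U))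
  · rintro _ ⟨x, hx, rfl⟩
    exact (smul_nonneg hc.le (show (0 : U) ≤ (x : U) from pD x hx) : (0 : U) ≤ c • (x : U))
  · constructor
    · rintro _ ⟨_, ⟨x, hx, rfl⟩, rfl⟩
      exact smul_le_smul_of_nonneg_left (lD.1 ⟨x, hx, rfl⟩) hc.le
    · intro u hu
      have h1 : f ≤ c⁻¹ • u := lD.2 (by
        rintro _ ⟨x, hx, rfl⟩
        have h2 : c • (x : U) ≤ u := hu ⟨c • x, ⟨x, hx, rfl⟩, rfl⟩
        have := smul_le_smul_of_nonneg_left h2 (inv_nonneg.2 hc.le)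
        rwa [inv_smul_smul₀ hc.ne'] at this)
      have := smul_le_smul_of_nonneg_left h1 hc.le
      rwa [smul_inv_smul₀ hc.ne'] at this
  · refine ⟨c • b, ?_⟩
    rintro _ ⟨_, ⟨x, hx, rfl⟩, rfl⟩
    have := smul_le_smul_of_nonneg_left (bD ⟨x, hx, rfl⟩) hc.le
    simpa using this

/-- The natural domain `L¹(T) = dom(T) - dom(T)` in `E^u`. -/
def L1 (E : Submodule ℝ U) (T : E →ₗ[ℝ] E) : Submodule ℝ U where
  carrier := {x | ∃ f ∈ naturalDomCone E T, ∃ g ∈ naturalDomCone E T, x = f - g}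
  zero_mem' := ⟨0, zero_mem_naturalDomCone E T, 0, zero_mem_naturalDomCone E T, by simp⟩
  add_mem' := by
    rintro _ _ ⟨f, hf, g, hg, rfl⟩ ⟨f', hf', g', hg', rfl⟩
    exact ⟨f + f', add_mem_naturalDomCone E T hf hf', g + g', add_mem_naturalDomCone E T hg hg',
      by abel⟩
  smul_mem' := by
    rintro c _ ⟨f, hf, g, hg, rfl⟩
    rcases le_total 0 c with hc | hc
    · exact ⟨c • f, smul_mem_naturalDomCone E T hc hf, c • g, smul_mem_naturalDomCone E T hc hg,
        smul_sub c f g⟩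
    · exact ⟨(-c) • g, smul_mem_naturalDomCone E T (neg_nonneg.2 hc) hg,
        (-c) • f, smul_mem_naturalDomCone E T (neg_nonneg.2 hc) hf, by
          rw [← smul_sub, neg_smul, ← smul_neg, neg_sub]⟩

theorem mem_L1_of_nonneg {E : Submodule ℝ U} (T : E →ₗ[ℝ] E) {w : E} (hw : 0 ≤ w) :
    (w : U) ∈ L1 E T :=
  ⟨w, ⟨{w}, by simp, by simp [DirectedOn], by simpa using hw, by simp, by simp⟩,
    0, zero_mem_naturalDomCone E T, by simp⟩

/-- `x ∈ L^p(T)`: `x ∈ L¹(T)` and the power `|x| ^ p` (the supremum, in `E^u`, of the lower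
spectral sums) belongs to `L¹(T)`. -/
structure MemLpT (E : Submodule ℝ U) (T : E →ₗ[ℝ] E) (e : U) (p : ℝ) (x : U) : Prop where
  mem_L1 : x ∈ L1 E T
  isLUB_pow : IsLUB (lowerSpectralSums (fun t => t ^ p) e |x|) (rieszPow e p |x|)
  pow_mem_L1 : rieszPow e p |x| ∈ L1 E T

/-- `|x| ^ p` as an element of `L¹(T)`, for `x ∈ L^p(T)`. -/
noncomputable def absPow {E : Submodule ℝ U} {T : E →ₗ[ℝ] E} {e : U} {p : ℝ} {x : U}
    (hx : MemLpT E T e p x) : L1 E T :=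
  ⟨rieszPow e p |x|, hx.pow_mem_L1⟩

end RieszSpace

open RieszSpace

namespace RieszSpace

set_option linter.unusedSectionVars false

/-! ### Disjointness in lattice-ordered groups. -/

section Lattice

variable {U : Type*} [Lattice U] [AddCommGroup U] [IsOrderedAddMonoid U]

/-! Write `Y i` for the power of `X i`, `y n = X n / a n`, and `B r n` for the component of `e` on
which `y n > r`. By Jensen `Y` is again a submartingale, and by Markov `r ^ p • B r n ≤ Y n / a n ^
p`. A Chow type maximal inequality then bounds `r ^ p • S 0 (sup_{i ≥ k} B r i)` by `t k / a k ^ p`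
plus the tail of the given series beyond `k`, where `t k = S 0 (Y k)`. A Kronecker argument shows
that this bound has infimum `0`. Strict positivity of `S 0` gives `limsup B r = 0` for every `r >
0`. Lateral completeness turns this into order convergence: it supplies a common upper bound of the
`y n`, so that the tail suprema exist and decrease to `0`.

No integral is computed. The power of `x` enters only through the tangents `s ^ p • e + p s ^ (p -
1) • (x - s • e)`: a positive element is above all lower spectral sums exactly when it is above all
tangents. Tangents are affine in `x`, so an operator fixing `e` passes through them. Pointwise
arguments become disjointness arguments: an inequality valid where `z` vanishes is one with an error
term `z`, which elements disjoint from `z` may drop. -/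

theorem inf_mono_eq_zero {a a' b b' : U} (ha : 0 ≤ a) (hb : 0 ≤ b) (haa : a ≤ a') (hbb : b ≤ b')
    (h : a' ⊓ b' = 0) : a ⊓ b = 0 :=
  le_antisymm ((inf_le_inf haa hbb).trans h.le) (le_inf ha hb)

theorem add_eq_sup_of_inf_eq_zero {a b : U} (h : a ⊓ b = 0) : a + b = a ⊔ b := by
  rw [← inf_add_sup a b, h, zero_add]

/-- Since `a + z = a ⊔ z ≤ y + z`, the term `z` cancels. This is how error terms are dropped
throughout. -/
theorem le_of_le_add_of_inf_eq_zero {a y z : U} (h : a ≤ y + z) (haz : a ⊓ z = 0) (hy : 0 ≤ y) :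
    a ≤ y := by
  have : a + z ≤ y + z := by
    rw [add_eq_sup_of_inf_eq_zero haz]
    exact sup_le h (le_add_of_nonneg_left hy)
  exact le_of_add_le_add_right this

theorem inf_add_eq_zero {a b c : U} (ha : 0 ≤ a) (hb : 0 ≤ b) (hc : 0 ≤ c) (hab : a ⊓ b = 0)
    (hac : a ⊓ c = 0) : a ⊓ (b + c) = 0 := by
  have h0 : 0 ≤ a ⊓ (b + c) := le_inf ha (add_nonneg hb hc)
  have h1 : a ⊓ (b + c) ≤ b :=
    le_of_le_add_of_inf_eq_zero inf_le_right (inf_mono_eq_zero h0 hc inf_le_left le_rfl hac) hb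
  exact le_antisymm ((le_inf inf_le_left h1).trans hab.le) h0

theorem inf_nsmul_eq_zero {a b : U} (ha : 0 ≤ a) (hb : 0 ≤ b) (hab : a ⊓ b = 0) (n : ℕ) :
    a ⊓ (n • b) = 0 := by
  induction n with
  | zero => simpa using ha
  | succ n ih =>
    rw [succ_nsmul]
    exact inf_add_eq_zero ha (nsmul_nonneg hb n) hb ih hab

theorem posPart_sub_inf_posPart_sub (a b : U) : (a - b)⁺ ⊓ (b - a)⁺ = 0 := by
  have := posPart_inf_negPart_eq_zero (a - b)
  rwa [← posPart_neg, neg_sub] at this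

/-- For `x ∈ A`, `a + x = a ⊔ x ≤ a ⊔ s = a + s - a ⊓ s`, so `s - a ⊓ s` is an upper bound of `A` as
well. -/
theorem inf_isLUB_eq_zero {a s : U} {A : Set U} (hA : IsLUB A s) (ha : 0 ≤ a)
    (hs : 0 ≤ s) (h : ∀ x ∈ A, a ⊓ x = 0) : a ⊓ s = 0 := by
  refine le_antisymm ?_ (le_inf ha hs)
  have : s ≤ s - a ⊓ s := hA.2 fun x hx => by
    have h1 : a + x = a ⊔ x := add_eq_sup_of_inf_eq_zero (h x hx)
    have h2 : a ⊔ x ≤ a ⊔ s := sup_le_sup_left (hA.1 hx) a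
    have h3 := inf_add_sup a s
    rw [le_sub_iff_add_le]
    have : a + x + a ⊓ s ≤ a + s := by
      rw [← h3, h1, add_comm]; exact add_le_add_right h2 _
    rw [add_assoc] at this
    exact le_of_add_le_add_left this
  simpa using this

end Lattice

/-! ### The Archimedean property. -/

section Archimedean

variable {U : Type*} [ConditionallyCompleteLattice U] [AddCommGroup U] [IsOrderedAddMonoid U]

/-- The supremum of the multiples of `c` does not change when the index is shifted by one, which
adds `c`. -/
theorem nonpos_of_forall_nsmul_le {c x : U} (h : ∀ n : ℕ, n • c ≤ x) : c ≤ 0 := by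
  have hb : BddAbove (Set.range fun n : ℕ => n • c) := ⟨x, by rintro _ ⟨n, rfl⟩; exact h n⟩
  have : (⨆ n : ℕ, n • c) ≤ (⨆ n : ℕ, n • c) - c := ciSup_le fun n => by
    rw [le_sub_iff_add_le, ← succ_nsmul]
    exact le_ciSup hb (n + 1)
  simpa using this

/-- If every truncation of `y` by multiples of `D` is below `u`, then `y ≤ u` on the band
generated by `D`. -/
theorem posPart_sub_inf_eq_zero {y u D : U} (hy : 0 ≤ y) (hD : 0 ≤ D)
    (h : ∀ m : ℕ, y ⊓ m • D ≤ u) : (y - u)⁺ ⊓ D = 0 := by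
  set c := (y - u)⁺ ⊓ D with hc
  have hc0 : 0 ≤ c := le_inf (posPart_nonneg _) hD
  refine le_antisymm (nonpos_of_forall_nsmul_le (x := y) fun m => ?_) hc0
  have hcd : (u - y)⁺ ⊓ c = 0 :=
    inf_mono_eq_zero (posPart_nonneg _) hc0 le_rfl inf_le_left (posPart_sub_inf_posPart_sub u y)
  -- If `m • c ≤ y`, then `m • c ≤ y ⊓ m • D ≤ u`. One more `c ≤ (y - u)⁺` gives at most `u ⊔ y = y
  -- + (u - y)⁺`, and `c` is disjoint from the last term.
  induction m with
  | zero => simpa using hy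
  | succ m ih =>
    have h1 : m • c ≤ u :=
      (le_inf ih (nsmul_le_nsmul_right (inf_le_right : c ≤ D) m)).trans (h m)
    have h2 : (m + 1) • c ≤ y + (u - y)⁺ := by
      have h3 : (m + 1) • c ≤ u + (y - u)⁺ := by
        rw [succ_nsmul]
        exact add_le_add h1 inf_le_left
      have h4 : u + (y - u)⁺ = y + (u - y)⁺ := by
        rw [posPart_def, posPart_def, add_sup, add_sup]
        simp [sup_comm]
      rwa [h4] at h3
    refine le_of_le_add_of_inf_eq_zero h2 ?_ hy
    rw [inf_comm]
    exact inf_nsmul_eq_zero (posPart_nonneg _) hc0 hcd _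

end Archimedean

section Module

variable {U : Type*} [ConditionallyCompleteLattice U] [AddCommGroup U] [IsOrderedAddMonoid U]
  [Module ℝ U] [IsOrderedModule ℝ U]

theorem inf_smul_eq_zero {a b : U} (ha : 0 ≤ a) (hb : 0 ≤ b) (hab : a ⊓ b = 0) {r : ℝ}
    (hr : 0 ≤ r) : a ⊓ (r • b) = 0 := by
  obtain ⟨n, hn⟩ := exists_nat_ge r
  refine inf_mono_eq_zero ha (smul_nonneg hr hb) le_rfl ?_ (inf_nsmul_eq_zero ha hb hab n)
  rw [← Nat.cast_smul_eq_nsmul ℝ]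
  exact smul_le_smul_of_nonneg_right hn hb

theorem le_of_forall_smul_add_le {x y z : U} (hz : 0 ≤ z)
    (h : ∀ r : ℝ, 0 < r → x ≤ y + r • z) : x ≤ y := by
  rw [← sub_nonpos]
  refine nonpos_of_forall_nsmul_le (x := z) fun n => ?_
  rcases n.eq_zero_or_pos with rfl | hn
  · simpa using hz
  have hn' : (0 : ℝ) < n := by exact_mod_cast hn
  have := smul_le_smul_of_nonneg_left (sub_le_iff_le_add'.2 (h (n : ℝ)⁻¹ (inv_pos.2 hn'))) hn'.le
  rwa [smul_inv_smul₀ hn'.ne', Nat.cast_smul_eq_nsmul] at this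

/-! ### Components in principal bands. -/

section BandComponent

variable {g f : U}

theorem bandComponent_isLUB (g f : U) :
    IsLUB (Set.range fun n : ℕ => f ⊓ ((n : ℝ) • g)) (bandComponent g f) :=
  isLUB_ciSup ⟨f, by rintro _ ⟨n, rfl⟩; exact inf_le_left⟩

theorem le_bandComponent (g f : U) (n : ℕ) : f ⊓ ((n : ℝ) • g) ≤ bandComponent g f :=
  (bandComponent_isLUB g f).1 ⟨n, rfl⟩

theorem bandComponent_le (g f : U) : bandComponent g f ≤ f :=
  (bandComponent_isLUB g f).2 (by rintro _ ⟨n, rfl⟩; exact inf_le_left)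

theorem bandComponent_nonneg (g : U) (hf : 0 ≤ f) : 0 ≤ bandComponent g f := by
  simpa [hf] using le_bandComponent g f 0

theorem bandComponent_mono {g' : U} (hg : g ≤ g') : bandComponent g f ≤ bandComponent g' f :=
  (bandComponent_isLUB g f).2 (by
    rintro _ ⟨n, rfl⟩
    exact (inf_le_inf_left f (smul_le_smul_of_nonneg_left hg n.cast_nonneg)).trans
      (le_bandComponent g' f n))

theorem inf_bandComponent_eq_zero {a : U} (ha : 0 ≤ a) (hg : 0 ≤ g) (hf : 0 ≤ f)
    (h : a ⊓ g = 0) : a ⊓ bandComponent g f = 0 := by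
  refine inf_isLUB_eq_zero (bandComponent_isLUB g f) ha (bandComponent_nonneg g hf) ?_
  rintro _ ⟨n, rfl⟩
  exact inf_mono_eq_zero ha (le_inf hf (smul_nonneg n.cast_nonneg hg)) le_rfl inf_le_right
    (inf_smul_eq_zero ha hg h n.cast_nonneg)

/-- If `n • c` is below the component, then `(n + 1) • c` is below both `f` and `(n + 1) • g`, hence
again below the component. So all multiples of `c` are bounded. -/
theorem inf_sub_bandComponent (hg : 0 ≤ g) (hf : 0 ≤ f) : g ⊓ (f - bandComponent g f) = 0 := by
  set c := g ⊓ (f - bandComponent g f) with hc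
  have hc0 : 0 ≤ c := le_inf hg (sub_nonneg.2 (bandComponent_le g f))
  have key : ∀ n : ℕ, n • c ≤ bandComponent g f := by
    intro n
    induction n with
    | zero => simpa using bandComponent_nonneg g hf
    | succ n ih =>
      refine le_trans (le_inf ?_ ?_) (le_bandComponent g f (n + 1))
      · rw [succ_nsmul]
        exact (add_le_add ih inf_le_right).trans (by simp)
      · rw [Nat.cast_smul_eq_nsmul]
        exact nsmul_le_nsmul_right inf_le_left _
  exact le_antisymm (nonpos_of_forall_nsmul_le key) hc0

theorem bandComponent_inf_sub (hg : 0 ≤ g) (hf : 0 ≤ f) :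
    bandComponent g f ⊓ (f - bandComponent g f) = 0 := by
  rw [inf_comm]
  refine inf_bandComponent_eq_zero (sub_nonneg.2 (bandComponent_le g f)) hg hf ?_
  rw [inf_comm]
  exact inf_sub_bandComponent hg hf

end BandComponent

/-! ### Powers through tangents. -/

section Power

variable {e x : U}

theorem spectralSystem_nonneg (he : 0 ≤ e) (x : U) (t : ℝ) : 0 ≤ spectralSystem e x t :=
  bandComponent_nonneg _ he

theorem spectralSystem_le (e x : U) (t : ℝ) : spectralSystem e x t ≤ e := bandComponent_le _ _

theorem spectralSystem_mono (he : 0 ≤ e) (x : U) : Monotone (spectralSystem e x) := by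
  intro s t hst
  refine bandComponent_mono (posPart_mono ?_)
  exact sub_le_sub_right (smul_le_smul_of_nonneg_right hst he) x

theorem spectralSystem_inf_sub (he : 0 ≤ e) (x : U) (t : ℝ) :
    spectralSystem e x t ⊓ (e - spectralSystem e x t) = 0 :=
  bandComponent_inf_sub (posPart_nonneg _) he

theorem le_smul_add_posPart (y z : U) : y ≤ z + (y - z)⁺ := by
  have := le_posPart (y - z)
  rwa [sub_le_iff_le_add'] at this

/-- An element above all tangents of `t ↦ t ^ p`, evaluated at `x`, is above the lower sums. -/
theorem lowerSpectralSums_le_of_tangents (he : 0 ≤ e) {p : ℝ} (hp : 1 ≤ p) {z : U} (hz : 0 ≤ z)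
    (h : ∀ s : ℝ, 0 ≤ s → s ^ p • e + (p * s ^ (p - 1)) • (x - s • e) ≤ z) :
    z ∈ upperBounds (lowerSpectralSums (fun t => t ^ p) e x) := by
  rintro _ ⟨n, t, ht0, ht, rfl⟩
  have htn : ∀ i, 0 ≤ t i := fun i => ht0.trans (ht (Nat.zero_le i))
  set E := spectralSystem e x with hE
  have hEm : Monotone E := spectralSystem_mono he x
  have hE0 : ∀ t, 0 ≤ E t := spectralSystem_nonneg he x
  have hq0 : ∀ i, 0 ≤ E (t (i + 1)) - E (t i) := fun i => sub_nonneg.2 (hEm (ht i.le_succ))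
  have hqe : ∀ i, E (t (i + 1)) - E (t i) ≤ e - E (t i) := fun i =>
    sub_le_sub_right (spectralSystem_le e x _) _
  -- On the `i`-th increment `x ≥ t i • e`, so the tangent at `t i` is at least `t i ^ p` there.
  have hterm : ∀ i, t i ^ p • (E (t (i + 1)) - E (t i)) ≤ z := by
    intro i
    have hc : 0 ≤ p * t i ^ (p - 1) :=
      mul_nonneg (by linarith) (Real.rpow_nonneg (htn i) _)
    have hdis : (t i • e - x)⁺ ⊓ (E (t (i + 1)) - E (t i)) = 0 :=
      inf_mono_eq_zero (posPart_nonneg _) (hq0 i) le_rfl (hqe i)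
        (inf_sub_bandComponent (posPart_nonneg _) he)
    refine le_of_le_add_of_inf_eq_zero (z := (p * t i ^ (p - 1)) • (t i • e - x)⁺) ?_ ?_ hz
    · have h1 := h (t i) (htn i)
      have h2 : t i ^ p • (E (t (i + 1)) - E (t i)) ≤ t i ^ p • e :=
        smul_le_smul_of_nonneg_left ((sub_le_self _ (hE0 _)).trans (spectralSystem_le e x _))
          (Real.rpow_nonneg (htn i) _)
      have h3 := smul_le_smul_of_nonneg_left (le_posPart (t i • e - x)) hc
      have h4 : t i ^ p • e ≤ z + (p * t i ^ (p - 1)) • (t i • e - x) := by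
        rw [← neg_sub x, smul_neg, ← sub_eq_add_neg, le_sub_iff_add_le]
        exact h1
      exact h2.trans (h4.trans (add_le_add_right h3 z))
    · refine inf_smul_eq_zero (smul_nonneg (Real.rpow_nonneg (htn i) _) (hq0 i))
        (posPart_nonneg _) ?_ hc
      rw [inf_comm]
      exact inf_smul_eq_zero (posPart_nonneg _) (hq0 i) hdis (Real.rpow_nonneg (htn i) _)
  -- The upper bound makes each partial sum disjoint from the next increment; the whole sum is then
  -- a supremum of terms, each below `z`.
  have hsum : ∀ n, 0 ≤ ∑ i ∈ Finset.range n, t i ^ p • (E (t (i + 1)) - E (t i)) ∧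
      ∑ i ∈ Finset.range n, t i ^ p • (E (t (i + 1)) - E (t i)) ≤ t n ^ p • E (t n) := by
    intro n
    refine ⟨Finset.sum_nonneg fun i _ => smul_nonneg (Real.rpow_nonneg (htn i) _) (hq0 i), ?_⟩
    calc ∑ i ∈ Finset.range n, t i ^ p • (E (t (i + 1)) - E (t i))
        ≤ ∑ i ∈ Finset.range n, t n ^ p • (E (t (i + 1)) - E (t i)) :=
          Finset.sum_le_sum fun i hi => smul_le_smul_of_nonneg_right
            (Real.rpow_le_rpow (htn i) (ht (Finset.mem_range.1 hi).le) (by linarith)) (hq0 i)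
      _ = t n ^ p • (E (t n) - E (t 0)) := by
          rw [← Finset.smul_sum, Finset.sum_range_sub (fun i => E (t i))]
      _ ≤ t n ^ p • E (t n) :=
          smul_le_smul_of_nonneg_left (sub_le_self _ (hE0 _)) (Real.rpow_nonneg (htn n) _)
  induction n with
  | zero => simpa using hz
  | succ n ih =>
    rw [Finset.sum_range_succ, add_eq_sup_of_inf_eq_zero]
    · exact sup_le ih (hterm n)
    · have hqn := hsum n
      refine inf_smul_eq_zero hqn.1 (hq0 n) ?_ (Real.rpow_nonneg (htn n) _)
      rw [inf_comm]
      refine inf_mono_eq_zero (hq0 n) hqn.1 (hqe n) hqn.2 ?_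
      refine inf_smul_eq_zero (sub_nonneg.2 (spectralSystem_le e x _)) (hE0 _) ?_
        (Real.rpow_nonneg (htn n) _)
      rw [inf_comm]
      exact spectralSystem_inf_sub he x (t n)

/-- Bernoulli's inequality at `t / s - 1`, multiplied by `s ^ p`. For `s = 0` the case `p = 1` is
separate because `0 ^ 0 = 1`. -/
theorem rpow_tangent_le {p : ℝ} (hp : 1 ≤ p) {s t : ℝ} (hs : 0 ≤ s) (ht : 0 ≤ t) :
    s ^ p + p * s ^ (p - 1) * (t - s) ≤ t ^ p := by
  rcases hs.eq_or_lt with rfl | hs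
  · rcases hp.eq_or_lt with rfl | hp
    · simp
    · rw [Real.zero_rpow (by linarith), Real.zero_rpow (by linarith)]
      simpa using Real.rpow_nonneg ht p
  · have h := one_add_mul_self_le_rpow_one_add (s := t / s - 1)
      (by linarith [div_nonneg ht hs.le]) hp
    have h1 : s ^ p * (1 + p * (t / s - 1)) ≤ s ^ p * (1 + (t / s - 1)) ^ p :=
      mul_le_mul_of_nonneg_left h (Real.rpow_nonneg hs.le p)
    rw [add_sub_cancel, ← Real.mul_rpow hs.le (div_nonneg ht hs.le),
      mul_div_cancel₀ _ hs.ne'] at h1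
    refine le_trans (le_of_eq ?_) h1
    rw [Real.rpow_sub_one hs.ne']
    field_simp

theorem lowerSpectralSums_single (f : ℝ → ℝ) (e x : U) {s t : ℝ} (hs : 0 ≤ s) (hst : s ≤ t) :
    f s • (spectralSystem e x t - spectralSystem e x s) ∈ lowerSpectralSums f e x := by
  refine ⟨1, fun i => if i = 0 then s else t, by simpa using hs, ?_, by simp⟩
  refine monotone_nat_of_le_succ fun n => ?_
  by_cases hn : n = 0 <;> simp [hn, hst]

/-- The power `x ^ p` is above the tangents of `t ↦ t ^ p`, evaluated at `x`. -/
theorem tangent_le_of_mem_upperBounds (he : 0 ≤ e) (hunit : ∀ y : U, 0 ≤ y → y ⊓ e = 0 → y = 0)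
    (hx : 0 ≤ x) {p : ℝ} (hp : 1 ≤ p) {Y : U}
    (hY : Y ∈ upperBounds (lowerSpectralSums (fun t => t ^ p) e x)) {s : ℝ} (hs : 0 ≤ s) :
    s ^ p • e + (p * s ^ (p - 1)) • (x - s • e) ≤ Y := by
  set c := p * s ^ (p - 1) with hc
  have hc0 : 0 ≤ c := mul_nonneg (by linarith) (Real.rpow_nonneg hs _)
  have hY0 : 0 ≤ Y := hY ⟨0, fun _ => 0, le_rfl, monotone_const, by simp⟩
  refine le_of_forall_smul_add_le (smul_nonneg hc0 he) fun δ hδ => ?_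
  rw [← sub_nonpos, ← posPart_eq_zero]
  set w := (s ^ p • e + c • (x - s • e) - (Y + δ • c • e))⁺ with hw
  have hw0 : 0 ≤ w := posPart_nonneg _
  set E := spectralSystem e x with hE
  have hEm : Monotone E := spectralSystem_mono he x
  have hE0 : ∀ t, 0 ≤ E t := spectralSystem_nonneg he x
  -- On the increment over `[t, t + δ]` one has `x ≤ (t + δ) • e` and `t ^ p ≤ Y`, so the tangent
  -- exceeds `Y` by at most the allowance `δ • c • e`.
  have hq : ∀ t, 0 ≤ t → w ⊓ (E (t + δ) - E t) = 0 := by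
    intro t ht
    have htp := Real.rpow_nonneg ht p
    set q := E (t + δ) - E t with hq
    have hq0 : 0 ≤ q := sub_nonneg.2 (hEm (by linarith))
    have hqE : q ≤ E (t + δ) := sub_le_self _ (hE0 _)
    have hqe : q ≤ e := hqE.trans (spectralSystem_le e x _)
    have h1 : t ^ p • q ≤ Y := hY (lowerSpectralSums_single _ e x ht (by linarith))
    have h2 : w ≤ t ^ p • (e - q) + c • (x - (t + δ) • e)⁺ := by
      refine sup_le ?_ (add_nonneg (smul_nonneg htp (sub_nonneg.2 hqe))
        (smul_nonneg hc0 (posPart_nonneg _)))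
      have h3 : (s ^ p + c * (t - s)) • e ≤ t ^ p • e :=
        smul_le_smul_of_nonneg_right (rpow_tangent_le hp hs ht) he
      have h4 := smul_le_smul_of_nonneg_left (le_posPart (x - (t + δ) • e)) hc0
      calc s ^ p • e + c • (x - s • e) - (Y + δ • c • e)
          = (s ^ p + c * (t - s)) • e - Y + c • (x - (t + δ) • e) := by module
        _ ≤ t ^ p • e - t ^ p • q + c • (x - (t + δ) • e)⁺ :=
          add_le_add (sub_le_sub h3 h1) h4
        _ = _ := by rw [smul_sub (t ^ p) e q]
    rw [inf_comm]
    refine inf_mono_eq_zero hq0 hw0 le_rfl h2 (inf_add_eq_zero hq0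
      (smul_nonneg htp (sub_nonneg.2 hqe)) (smul_nonneg hc0 (posPart_nonneg _)) ?_ ?_)
    · refine inf_smul_eq_zero hq0 (sub_nonneg.2 hqe) ?_ htp
      have h5 : e - q = (e - E (t + δ)) + E t := by rw [hq]; abel
      rw [h5]
      refine inf_add_eq_zero hq0 (sub_nonneg.2 (spectralSystem_le e x _)) (hE0 _) ?_ ?_
      · exact inf_mono_eq_zero hq0 (sub_nonneg.2 (spectralSystem_le e x _)) hqE le_rfl
          (spectralSystem_inf_sub he x _)
      · rw [inf_comm]
        exact inf_mono_eq_zero (hE0 _) hq0 le_rfl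
          (sub_le_sub_right (spectralSystem_le e x _) _) (spectralSystem_inf_sub he x t)
    · refine inf_smul_eq_zero hq0 (posPart_nonneg _) ?_ hc0
      rw [inf_comm]
      exact inf_mono_eq_zero (posPart_nonneg _) hq0 le_rfl hqE
        (inf_bandComponent_eq_zero (posPart_nonneg _) (posPart_nonneg _) he
          (posPart_sub_inf_posPart_sub _ _))
  have hwE : ∀ n : ℕ, w ⊓ E (n * δ) = 0 := by
    intro n
    induction n with
    | zero =>
      have : E 0 = 0 := by
        simp [hE, spectralSystem, bandComponent, posPart_eq_zero.2 (neg_nonpos.2 hx), he]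
      simpa [this] using hw0
    | succ n ih =>
      have h1 : E ((n + 1 : ℕ) * δ) = E (n * δ) + (E (n * δ + δ) - E (n * δ)) := by
        push_cast
        rw [add_mul, one_mul]
        abel
      rw [h1]
      exact inf_add_eq_zero hw0 (hE0 _) (sub_nonneg.2 (hEm (by linarith))) ih
        (hq _ (by positivity))
  refine hunit w hw0 ?_
  set r := w ⊓ e with hr
  have hr0 : 0 ≤ r := le_inf hw0 he
  -- Since `w` misses every `E (n * δ)`, `x` is at least `n * δ` wherever `r` lives; this is the
  -- fact that the spectral system increases to `e`.
  have key : ∀ n : ℕ, n • (δ • r) ≤ x := by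
    intro n
    have h1 : r ⊓ (((n : ℝ) * δ) • e - x)⁺ = 0 := by
      refine le_antisymm ?_ (le_inf hr0 (posPart_nonneg _))
      have h2 : e ⊓ (((n : ℝ) * δ) • e - x)⁺ ≤ E (n * δ) := by
        have := le_bandComponent ((((n : ℝ) * δ) • e - x)⁺) e 1
        rwa [Nat.cast_one, one_smul] at this
      rw [hr, inf_assoc]
      exact (inf_le_inf_left w h2).trans (hwE n).le
    have h3 : 0 ≤ (n : ℝ) * δ := by positivity
    rw [← Nat.cast_smul_eq_nsmul ℝ, smul_smul]
    refine le_of_le_add_of_inf_eq_zero (z := (((n : ℝ) * δ) • e - x)⁺) ?_ ?_ hx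
    · exact (smul_le_smul_of_nonneg_left (inf_le_right : r ≤ e) h3).trans
        (le_smul_add_posPart _ _)
    · rw [inf_comm]
      rw [inf_comm] at h1
      exact inf_smul_eq_zero (posPart_nonneg _) hr0 h1 h3
  have h5 := nonpos_of_forall_nsmul_le key
  have h6 := smul_le_smul_of_nonneg_left h5 (inv_nonneg.2 hδ.le)
  rw [inv_smul_smul₀ hδ.ne', smul_zero] at h6
  exact le_antisymm h6 hr0

/-- Markov's inequality on a component: `s ^ p ≤ Y` on `{x > s}`. -/
theorem smul_bandComponent_le_of_tangent (he : 0 ≤ e) {p s : ℝ} (hp : 1 ≤ p) (hs : 0 ≤ s) {Y : U}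
    (hY0 : 0 ≤ Y) (hY : s ^ p • e + (p * s ^ (p - 1)) • (x - s • e) ≤ Y) :
    s ^ p • bandComponent (x - s • e)⁺ e ≤ Y := by
  have hc : 0 ≤ p * s ^ (p - 1) := mul_nonneg (by linarith) (Real.rpow_nonneg hs _)
  have hsp := Real.rpow_nonneg hs p
  have hB0 : 0 ≤ bandComponent (x - s • e)⁺ e := bandComponent_nonneg _ he
  refine le_of_le_add_of_inf_eq_zero (z := (p * s ^ (p - 1)) • (s • e - x)⁺) ?_ ?_ hY0
  · have h3 := smul_le_smul_of_nonneg_left (le_posPart (s • e - x)) hc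
    have h4 : s ^ p • e ≤ Y + (p * s ^ (p - 1)) • (s • e - x) := by
      rw [← neg_sub x, smul_neg, ← sub_eq_add_neg, le_sub_iff_add_le]
      exact hY
    exact (smul_le_smul_of_nonneg_left (bandComponent_le _ e) hsp).trans
      (h4.trans (add_le_add_right h3 Y))
  · refine inf_smul_eq_zero (smul_nonneg hsp hB0) (posPart_nonneg _) ?_ hc
    rw [inf_comm]
    exact inf_smul_eq_zero (posPart_nonneg _) hB0 (inf_bandComponent_eq_zero (posPart_nonneg _)
      (posPart_nonneg _) he (posPart_sub_inf_posPart_sub _ _)) hsp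

end Power

/-! ### Order ideals in the universal completion. -/

section NaturalDomain

variable {E : Submodule ℝ U}

theorem unit_of_orderDense (hd : ∀ u : U, 0 < u → ∃ x ∈ E, 0 < x ∧ x ≤ u) {e : E}
    (he : IsWeakOrderUnit E e) (y : U) (hy : 0 ≤ y) (hye : y ⊓ e = 0) : y = 0 := by
  by_contra hne
  obtain ⟨x, hxE, hx0, hxy⟩ := hd y (lt_of_le_of_ne hy (Ne.symm hne))
  have := he.2 ⟨x, hxE⟩ hx0.le (inf_mono_eq_zero hx0.le he.1 hxy le_rfl hye)
  exact hx0.ne' (congrArg Subtype.val this)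

/-- Suprema in an order dense Riesz subspace are suprema in the ambient space. -/
theorem isLUB_coe_of_orderDense
    (hd : ∀ u : U, 0 < u → ∃ x ∈ E, 0 < x ∧ x ≤ u) {A : Set E} {s : E} (hs : IsLUB A s) :
    IsLUB ((fun a : E => (a : U)) '' A) s := by
  refine ⟨by rintro _ ⟨a, ha, rfl⟩; exact hs.1 ha, fun u hu => ?_⟩
  by_contra hne
  have hpos : 0 < (s : U) - (s : U) ⊓ u := by
    rw [sub_pos]
    exact lt_of_le_of_ne inf_le_left fun h => hne (inf_eq_left.1 h)
  obtain ⟨x, hxE, hx0, hx⟩ := hd _ hpos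
  have h1 : s ≤ s - ⟨x, hxE⟩ := hs.2 fun a ha => by
    change (a : U) ≤ s - x
    have h2 : (a : U) ≤ (s : U) ⊓ u := le_inf (hs.1 ha) (hu ⟨a, ha, rfl⟩)
    exact h2.trans (le_sub_comm.1 hx)
  have h3 : (s : U) ≤ s - x := h1
  exact hx0.not_ge (by simpa using h3)

/-- The directed set for `v` consists of all positive elements of `E` below `v`. For such `d`, `d`
is the supremum of the `d ⊓ g` with `g ∈ D`, so order continuity carries the bound `b` over to `T
d`. -/
theorem naturalDomCone_solid (hE : IsDedekindCompleteRieszSubspace E)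
    (hd : ∀ u : U, 0 < u → ∃ x ∈ E, 0 < x ∧ x ≤ u) {T : E →ₗ[ℝ] E} (hT : IsCondExp E T)
    {f v : U} (hf : f ∈ naturalDomCone E T) (hv : 0 ≤ v) (hvf : v ≤ f) :
    v ∈ naturalDomCone E T := by
  obtain ⟨D, hD, dD, pD, lD, ⟨b, bD⟩⟩ := hf
  have hTm : ∀ x y : E, x ≤ y → T x ≤ T y := fun x y hxy => by
    have := hT.positive (y - x) (by rwa [← sub_nonneg] at hxy)
    rw [map_sub] at this
    exact sub_nonneg.1 this
  refine ⟨{d | 0 ≤ d ∧ (d : U) ≤ v}, ⟨0, le_rfl, hv⟩, ?_, fun d hd => hd.1, ?_, b, ?_⟩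
  · rintro x ⟨hx0, hx⟩ y ⟨hy0, hy⟩
    exact ⟨⟨x ⊔ y, hE.sup_mem _ x.2 _ y.2⟩, ⟨(show (0 : U) ≤ x from hx0).trans le_sup_left,
      sup_le hx hy⟩, (le_sup_left : (x : U) ≤ (x : U) ⊔ y), (le_sup_right : (y : U) ≤ (x : U) ⊔ y)⟩
  · refine ⟨by rintro _ ⟨d, hd, rfl⟩; exact hd.2, fun u hu => ?_⟩
    by_contra hne
    have hpos : 0 < v - v ⊓ u := by
      rw [sub_pos]
      exact lt_of_le_of_ne inf_le_left fun h => hne (inf_eq_left.1 h)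
    obtain ⟨x, hxE, hx0, hx⟩ := hd _ hpos
    -- An element of `E` fitting between `v ⊓ u` and `v` could be added again and again.
    have key : ∀ n : ℕ, n • x ≤ v ⊓ u := by
      intro n
      induction n with
      | zero =>
        simpa using ⟨hv, hu ⟨0, ⟨le_rfl, by simpa using hv⟩, rfl⟩⟩
      | succ n ih =>
        have h1 : (n + 1) • x ≤ v := by
          rw [succ_nsmul]
          calc n • x + x ≤ v ⊓ u + (v - v ⊓ u) := add_le_add ih hx
            _ = v := by abel
        exact le_inf h1 (hu ⟨⟨(n + 1) • x, E.nsmul_mem hxE _⟩,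
          ⟨(nsmul_nonneg hx0.le _ : (0 : U) ≤ _), h1⟩, rfl⟩)
    exact hx0.not_ge (nonpos_of_forall_nsmul_le key)
  · rintro _ ⟨d, ⟨hd0, hdv⟩, rfl⟩
    let m : E → E := fun g => ⟨(d : U) ⊓ g, hE.inf_mem _ d.2 _ g.2⟩
    have hlub : IsGLB ((fun g => d - m g) '' D) 0 := by
      refine ⟨?_, fun l hl => ?_⟩
      · rintro _ ⟨g, -, rfl⟩
        exact sub_nonneg.2 (inf_le_left : (d : U) ⊓ g ≤ d)
      · change (l : U) ≤ 0
        have h1 : ∀ g ∈ D, (l : U) ≤ d - (d : U) ⊓ g := fun g hg => hl ⟨g, hg, rfl⟩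
        have h2 : f ≤ f - (l : U)⁺ := lD.2 (by
          rintro _ ⟨g, hg, rfl⟩
          have h3 : (l : U)⁺ ≤ d - (d : U) ⊓ g := sup_le (h1 g hg) (sub_nonneg.2 inf_le_left)
          have h4 : (g : U) + (l : U)⁺ ≤ (d : U) ⊔ g := by
            have := inf_add_sup (d : U) g
            calc (g : U) + (l : U)⁺ ≤ g + (d - (d : U) ⊓ g) := add_le_add_right h3 _
              _ = (d : U) ⊔ g := by rw [← sub_eq_of_eq_add' this.symm]; abel
          exact le_sub_iff_add_le.2 (h4.trans (sup_le (hdv.trans hvf) (lD.1 ⟨g, hg, rfl⟩))))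
        exact (le_posPart _).trans (by simpa using h2)
    have hdir : DirectedOn (· ≥ ·) ((fun g => d - m g) '' D) := by
      rintro _ ⟨g, hg, rfl⟩ _ ⟨g', hg', rfl⟩
      obtain ⟨k, hk, h1, h2⟩ := dD g hg g' hg'
      refine ⟨_, ⟨k, hk, rfl⟩, ?_, ?_⟩
      · exact sub_le_sub_left (inf_le_inf_left (d : U) (show (g : U) ≤ k from h1)) _
      · exact sub_le_sub_left (inf_le_inf_left (d : U) (show (g' : U) ≤ k from h2)) _
    have h1 := hT.orderContinuous _ (hD.image _) hdir hlub
    have h2 : IsLUB ((fun g => T (m g)) '' D) (T d) := by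
      refine ⟨?_, fun u hu => ?_⟩
      · rintro _ ⟨g, -, rfl⟩
        exact hTm _ _ (inf_le_left : (d : U) ⊓ g ≤ d)
      · have : T d - u ≤ 0 := h1.2 (by
          rintro _ ⟨_, ⟨g, hg, rfl⟩, rfl⟩
          rw [map_sub]
          exact sub_le_sub_left (show (T (m g) : U) ≤ u from hu ⟨g, hg, rfl⟩) _)
        exact sub_nonpos.1 this
    -- The bound `b` need not lie in `E`, so the supremum has to be one in the ambient space.
    refine (isLUB_coe_of_orderDense hd h2).2 ?_
    rintro _ ⟨_, ⟨g, hg, rfl⟩, rfl⟩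
    exact le_trans (hTm (m g) g (inf_le_right : (d : U) ⊓ g ≤ g)) (bD ⟨g, hg, rfl⟩)

theorem naturalDomCone_nonneg {T : E →ₗ[ℝ] E} {f : U} (hf : f ∈ naturalDomCone E T) : 0 ≤ f := by
  obtain ⟨D, ⟨d, hd⟩, -, pD, lD, -⟩ := hf
  exact (show (0 : U) ≤ d from pD d hd).trans (lD.1 ⟨d, hd, rfl⟩)

/-- Keeps components of `e` and their suprema inside `L1`, where the conditional expectations act.
-/
theorem L1_solid (hE : IsDedekindCompleteRieszSubspace E)
    (hd : ∀ u : U, 0 < u → ∃ x ∈ E, 0 < x ∧ x ≤ u) {T : E →ₗ[ℝ] E} (hT : IsCondExp E T)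
    {x v : U} (hx : x ∈ L1 E T) (hv : 0 ≤ v) (hvx : v ≤ x) : v ∈ L1 E T := by
  obtain ⟨f, hf, g, hg, rfl⟩ := hx
  exact ⟨v, naturalDomCone_solid hE hd hT hf hv
    (hvx.trans (sub_le_self f (naturalDomCone_nonneg hg))), 0, zero_mem_naturalDomCone E T,
    by simp⟩

end NaturalDomain

/-! ### Conditional expectations on an order ideal. -/

section CondExp

variable {F : Submodule ℝ U} {S : F →ₗ[ℝ] F}

theorem IsCondExp.mono (hS : IsCondExp F S) {x y : F} (h : x ≤ y) : S x ≤ S y := by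
  have := hS.positive (y - x) (sub_nonneg.2 (show (x : U) ≤ y from h))
  rw [map_sub] at this
  exact sub_nonneg.1 (show (0 : U) ≤ S y - S x from this)

theorem IsCondExp.isLUB_of_monotone (hF : ∀ x ∈ F, ∀ v : U, 0 ≤ v → v ≤ x → v ∈ F)
    (hS : IsCondExp F S) {u : ℕ → F} (hu : Monotone u) {s : F}
    (hs : IsLUB (Set.range fun n => (u n : U)) s) :
    IsLUB (Set.range fun n => (S (u n) : U)) (S s) := by
  have hle : ∀ n, u n ≤ s := fun n => hs.1 ⟨n, rfl⟩
  have hglb : IsGLB (Set.range fun n => s - u n) 0 := by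
    refine ⟨?_, fun l hl => ?_⟩
    · rintro _ ⟨n, rfl⟩
      exact sub_nonneg.2 (show (u n : U) ≤ s from hle n)
    · have : (s : U) ≤ s - l := hs.2 (by
        rintro _ ⟨n, rfl⟩
        exact le_sub_comm.1 (show (l : U) ≤ s - u n from hl ⟨n, rfl⟩))
      exact (show (l : U) ≤ 0 by simpa using this)
  have hdir : DirectedOn (· ≥ ·) (Set.range fun n => s - u n) := by
    rintro _ ⟨m, rfl⟩ _ ⟨n, rfl⟩
    exact ⟨_, ⟨max m n, rfl⟩, sub_le_sub_left (show (u m : U) ≤ _ from hu (le_max_left m n)) _,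
      sub_le_sub_left (show (u n : U) ≤ _ from hu (le_max_right m n)) _⟩
  have h := hS.orderContinuous _ (Set.range_nonempty _) hdir hglb
  refine ⟨?_, fun v hv => ?_⟩
  · rintro _ ⟨n, rfl⟩
    exact hS.mono (hle n)
  -- The bound `v` may lie outside `F`, but this positive part is below `S s - S (u 0)`, so it lies
  -- in the ideal.
  · have hmem : ((S s : U) - v)⁺ ∈ F := by
      refine hF (S s - S (u 0)) (Submodule.sub_mem _ (S s).2 (S (u 0)).2) _ (posPart_nonneg _) ?_
      exact sup_le (sub_le_sub_left (hv ⟨0, rfl⟩) _) (sub_nonneg.2 (hS.mono (hle 0)))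
    have h0 : (⟨_, hmem⟩ : F) ≤ 0 := h.2 (by
      rintro _ ⟨_, ⟨n, rfl⟩, rfl⟩
      rw [map_sub]
      exact sup_le (sub_le_sub_left (hv ⟨n, rfl⟩) _) (sub_nonneg.2 (hS.mono (hle n))))
    exact sub_nonpos.1 ((le_posPart _).trans h0)

theorem mem_range_iff_of_condExp (hS : IsCondExp F S) {u : U} :
    u ∈ (LinearMap.range S).map F.subtype ↔ ∃ h : u ∈ F, S ⟨u, h⟩ = ⟨u, h⟩ := by
  constructor
  · rintro ⟨_, ⟨y, rfl⟩, rfl⟩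
    exact ⟨(S y).2, hS.projection y⟩
  · rintro ⟨h, hu⟩
    exact ⟨⟨u, h⟩, ⟨⟨u, h⟩, hu⟩, rfl⟩

/-- Each truncation `f ⊓ n • g` is fixed by `S`, and order continuity passes this to their
increasing supremum. -/
theorem bandComponent_mem_range (hF : ∀ x ∈ F, ∀ v : U, 0 ≤ v → v ≤ x → v ∈ F)
    (hS : IsCondExp F S) {g f : U} (hg0 : 0 ≤ g) (hf0 : 0 ≤ f)
    (hg : g ∈ (LinearMap.range S).map F.subtype) (hf : f ∈ (LinearMap.range S).map F.subtype) :
    bandComponent g f ∈ (LinearMap.range S).map F.subtype := by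
  obtain ⟨hfF, -⟩ := (mem_range_iff_of_condExp hS).1 hf
  have hmem : bandComponent g f ∈ F := hF f hfF _ (bandComponent_nonneg g hf0) (bandComponent_le g f)
  have hu : ∀ n : ℕ, f ⊓ ((n : ℝ) • g) ∈ (LinearMap.range S).map F.subtype := fun n =>
    hS.range_complete.inf_mem _ hf _ (Submodule.smul_mem _ _ hg)
  have hfix := fun n => (mem_range_iff_of_condExp hS).1 (hu n)
  refine (mem_range_iff_of_condExp hS).2 ⟨hmem, Subtype.ext ?_⟩
  have h := hS.isLUB_of_monotone hF (u := fun n => ⟨_, (hfix n).1⟩) (s := ⟨_, hmem⟩) ?_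
    (bandComponent_isLUB g f)
  · refine h.unique ?_
    simp_rw [(hfix _).2]
    exact bandComponent_isLUB g f
  · intro m n hmn
    exact inf_le_inf_left f (smul_le_smul_of_nonneg_right (by exact_mod_cast hmn) hg0)

/-- The averaging property, for the supremum with a component of `e` in the range. -/
theorem IsCondExp.map_sup_le (hS : IsCondExp F S) {e B G H : F} (hSe : S e = e) (hSB : S B = B)
    (hB : (B : U) ⊓ (e - B) = 0) (hBe : B ≤ e) (hG0 : 0 ≤ G) (hGe : G ≤ e)
    (hH : (H : U) = (B : U) ⊔ G) : (S H : U) ≤ (B : U) ⊔ S G := by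
  have h1 : ((H - B : F) : U) ≤ G := by
    change (H : U) - B ≤ G
    rw [hH, sub_le_iff_le_add]
    have : (0 : U) ≤ B := hB ▸ inf_le_left
    exact sup_le (le_add_of_nonneg_left hG0) (le_add_of_nonneg_right this)
  have h2 : ((H - B : F) : U) ≤ e - B := by
    change (H : U) - B ≤ e - B
    rw [hH]
    exact sub_le_sub_right (sup_le hBe hGe) _
  have h0 : (0 : U) ≤ H - B := by rw [hH]; exact sub_nonneg.2 le_sup_left
  have h3 : S (H - B) ≤ S G := hS.mono h1
  have h4 : S (H - B) ≤ S (e - B) := hS.mono h2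
  rw [map_sub, map_sub, hSe, hSB] at h4
  rw [map_sub, hSB] at h3
  have h5 : 0 ≤ S (H - B) := hS.positive _ h0
  rw [map_sub, hSB] at h5
  -- `S (H - B)` stays below `e - B`, hence off `B`, so adding `B` to it is taking the supremum with
  -- `B`.
  have h6 : (B : U) ⊓ (S H - B) = 0 :=
    inf_mono_eq_zero (hB ▸ inf_le_left) h5 le_rfl (show (S H : U) - B ≤ e - B from h4) hB
  have h7 := add_eq_sup_of_inf_eq_zero h6
  rw [add_sub_cancel] at h7
  rw [h7]
  exact sup_le_sup_left (show (S H : U) - B ≤ S G from h3) _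

end CondExp

/-! ### Order convergence and a Kronecker lemma. -/

section OrderConvergence

/-- A sequence of positive elements is bounded if it is bounded by `e` off a decreasing sequence
of components of `e` with infimum `0`. -/
theorem exists_bound_of_components (hlat : IsLaterallyComplete U) {e : U} (he : 0 ≤ e)
    (hunit : ∀ y : U, 0 ≤ y → y ⊓ e = 0 → y = 0) {y : ℕ → U} (hy : ∀ n, 0 ≤ y n) {G : ℕ → U}
    (hG : Antitone G) (hGinf : IsGLB (Set.range G) 0) (hGe : ∀ k, G k ≤ e)
    (hGc : ∀ k, G k ⊓ (e - G k) = 0)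
    (hyG : ∀ k n, k ≤ n → (y n - e)⁺ ⊓ (e - G k) = 0) : ∃ u, ∀ n, y n ≤ u := by
  have hG0 : ∀ k, 0 ≤ G k := fun k => hGinf.1 ⟨k, rfl⟩
  -- On the shell `D k` only `y 0, …, y k` can exceed `e`. Their maxima, cut down to the disjoint
  -- shells, have a supremum `u` by lateral completeness, and `u + e` is the bound.
  set D : ℕ → U := fun k => G k - G (k + 1) with hD
  have hD0 : ∀ k, 0 ≤ D k := fun k => sub_nonneg.2 (hG k.le_succ)
  have hDlt : ∀ k l, k < l → D k ⊓ D l = 0 := fun k l hkl => by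
    rw [inf_comm]
    exact inf_mono_eq_zero (hD0 l) (hD0 k) ((sub_le_self _ (hG0 _)).trans (hG hkl))
      (sub_le_sub_right (hGe k) _) (hGc (k + 1))
  have hDD : ∀ k l, k ≠ l → D k ⊓ D l = 0 := fun k l hkl => by
    rcases hkl.lt_or_gt with h | h
    · exact hDlt k l h
    · rw [inf_comm]; exact hDlt l k h
  have hw0 : ∀ k, 0 ≤ partialSups y k := fun k => (hy 0).trans (le_partialSups_of_le y k.zero_le)
  set d : ℕ → U := fun k => bandComponent (D k) (partialSups y k) with hd
  have hdd : ∀ k l, k ≠ l → d k ⊓ d l = 0 := fun k l hkl => by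
    refine inf_bandComponent_eq_zero (bandComponent_nonneg _ (hw0 k)) (hD0 l) (hw0 l) ?_
    rw [inf_comm]
    exact inf_bandComponent_eq_zero (hD0 l) (hD0 k) (hw0 k) (hDD l k hkl.symm)
  obtain ⟨u, hu⟩ := hlat (Set.range d) (Set.range_nonempty d)
    (by rintro _ ⟨k, rfl⟩; exact bandComponent_nonneg _ (hw0 k))
    (by
      rintro _ ⟨k, rfl⟩ _ ⟨l, rfl⟩ hne
      exact hdd k l fun h => hne (by rw [h]))
  have hu0 : 0 ≤ u := (bandComponent_nonneg _ (hw0 0)).trans (hu.1 ⟨0, rfl⟩)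
  refine ⟨u + e, fun n => ?_⟩
  rw [← sub_nonpos, ← posPart_eq_zero]
  set w := (y n - (u + e))⁺ with hw
  have hw0 : 0 ≤ w := posPart_nonneg _
  have hwu : w ≤ (y n - u)⁺ := posPart_mono (sub_le_sub_left (le_add_of_nonneg_right he) _)
  have hwe : w ≤ (y n - e)⁺ := posPart_mono (sub_le_sub_left (le_add_of_nonneg_left hu0) _)
  have hwG : ∀ k ≤ n, w ⊓ (e - G k) = 0 := fun k hk =>
    inf_mono_eq_zero hw0 (sub_nonneg.2 (hGe k)) hwe le_rfl (hyG k n hk)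
  have hwD : ∀ k, w ⊓ D k = 0 := by
    intro k
    rcases Nat.lt_or_ge k n with hk | hk
    · exact inf_mono_eq_zero hw0 (hD0 k) le_rfl (sub_le_sub_right (hGe k) _) (hwG (k + 1) hk)
    · refine inf_mono_eq_zero hw0 (hD0 k) hwu le_rfl
        (posPart_sub_inf_eq_zero (hy n) (hD0 k) fun m => ?_)
      refine le_trans ?_ (hu.1 ⟨k, rfl⟩)
      refine le_trans ?_ (le_bandComponent (D k) (partialSups y k) m)
      rw [Nat.cast_smul_eq_nsmul]
      exact inf_le_inf_right _ (le_partialSups_of_le y hk)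
  refine hunit w hw0 (le_antisymm (hGinf.2 ?_) (le_inf hw0 he))
  have hr0 : 0 ≤ w ⊓ e := le_inf hw0 he
  rintro _ ⟨k, rfl⟩
  induction k with
  | zero =>
    refine le_of_le_add_of_inf_eq_zero (z := e - G 0) (by simp) ?_ (hG0 0)
    exact inf_mono_eq_zero hr0 (sub_nonneg.2 (hGe 0)) inf_le_left le_rfl (hwG 0 n.zero_le)
  | succ k ih =>
    refine le_of_le_add_of_inf_eq_zero (z := D k) (by simpa [hD] using ih) ?_ (hG0 _)
    exact inf_mono_eq_zero hr0 (hD0 k) inf_le_left le_rfl (hwD k)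

/-- Order convergence to `0` from control of the components on which a sequence is large. -/
theorem orderTendsto_zero_of_components (hlat : IsLaterallyComplete U) {e : U} (he : 0 ≤ e)
    (hunit : ∀ y : U, 0 ≤ y → y ⊓ e = 0 → y = 0) {y : ℕ → U} (hy : ∀ n, 0 ≤ y n)
    {G : ℝ → ℕ → U} (hG : ∀ r, Antitone (G r))
    (hGinf : ∀ r, 0 < r → IsGLB (Set.range (G r)) 0) (hGe : ∀ r k, G r k ≤ e)
    (hGc : ∀ r k, G r k ⊓ (e - G r k) = 0)
    (hyG : ∀ r k n, k ≤ n → (y n - r • e)⁺ ⊓ (e - G r k) = 0) : OrderTendsto y 0 := by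
  -- The level `r = 1` already gives boundedness; all levels `r > 0` are needed for the limit.
  obtain ⟨u, hu⟩ := exists_bound_of_components hlat he hunit hy (hG 1) (hGinf 1 one_pos) (hGe 1)
    (hGc 1) (by simpa using hyG 1)
  have hb : ∀ k, BddAbove (Set.range fun i => y (k + i)) := fun k =>
    ⟨u, by rintro _ ⟨i, rfl⟩; exact hu _⟩
  set v : ℕ → U := fun k => ⨆ i, y (k + i) with hv
  have hyv : ∀ k, y k ≤ v k := fun k => le_ciSup (hb k) 0
  have hv0 : ∀ k, 0 ≤ v k := fun k => (hy k).trans (hyv k)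
  refine ⟨v, fun k l hkl => ciSup_le fun i => ?_, ⟨?_, fun l hl => ?_⟩, fun n => ?_⟩
  · obtain ⟨j, rfl⟩ := Nat.exists_eq_add_of_le hkl
    rw [add_assoc]
    exact le_ciSup (hb k) (j + i)
  · rintro _ ⟨k, rfl⟩
    exact hv0 k
  · refine le_of_forall_smul_add_le he fun r hr => ?_
    rw [zero_add, ← sub_nonpos, ← posPart_eq_zero]
    have h0 := posPart_nonneg (l - r • e)
    refine hunit _ h0 (le_antisymm ((hGinf r hr).2 ?_) (le_inf h0 he))
    rintro _ ⟨k, rfl⟩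
    have hG0 : 0 ≤ G r k := (hGinf r hr).1 ⟨k, rfl⟩
    have hec : 0 ≤ e - G r k := sub_nonneg.2 (hGe r k)
    have hlub : IsLUB (Set.range fun i => (y (k + i) - r • e)⁺) (v k - r • e)⁺ := by
      refine ⟨?_, fun z hz => sup_le ?_ ((posPart_nonneg _).trans (hz ⟨0, rfl⟩))⟩
      · rintro _ ⟨i, rfl⟩
        exact posPart_mono (sub_le_sub_right (le_ciSup (hb k) i) _)
      · rw [sub_le_iff_le_add]
        exact ciSup_le fun i => sub_le_iff_le_add.1 ((le_posPart _).trans (hz ⟨i, rfl⟩))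
    have h1 : (e - G r k) ⊓ (v k - r • e)⁺ = 0 := by
      refine inf_isLUB_eq_zero hlub hec (posPart_nonneg _) ?_
      rintro _ ⟨i, rfl⟩
      rw [inf_comm]
      exact hyG r k (k + i) (Nat.le_add_right k i)
    rw [inf_comm] at h1
    refine le_of_le_add_of_inf_eq_zero (z := e - G r k) (by simp) ?_ hG0
    exact inf_mono_eq_zero (le_inf h0 he) hec
      (inf_le_left.trans (posPart_mono (sub_le_sub_right (hl ⟨k, rfl⟩) _))) le_rfl h1
  · rw [sub_zero, abs_of_nonneg (hy n)]
    exact hyv n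

/-- A Kronecker type lemma: `t k / b k + (s - ∑ i < k, (t (i + 1) - t i) / b (i + 1))` has infimum
`0` if the series has the order sum `s`, `t` is non-decreasing and `b` increases to `∞`. -/
theorem isGLB_of_orderTendsto_sum {t : ℕ → U} (ht0 : ∀ n, 0 ≤ t n) (ht : Monotone t) {b : ℕ → ℝ}
    (hb : ∀ i, 0 < b i) (hbm : Monotone b) (hblim : Filter.Tendsto b Filter.atTop Filter.atTop)
    {s : U}
    (hs : OrderTendsto (fun n => ∑ i ∈ Finset.range n, (b (i + 1))⁻¹ • (t (i + 1) - t i)) s) :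
    (∀ n, ∑ i ∈ Finset.range n, (b (i + 1))⁻¹ • (t (i + 1) - t i) ≤ s) ∧
    IsGLB (Set.range fun k => (b k)⁻¹ • t k +
      (s - ∑ i ∈ Finset.range k, (b (i + 1))⁻¹ • (t (i + 1) - t i))) 0 := by
  set σ : ℕ → U := fun n => ∑ i ∈ Finset.range n, (b (i + 1))⁻¹ • (t (i + 1) - t i) with hσ
  obtain ⟨v, hvm, hv, hsv⟩ := hs
  have hσs : ∀ n, σ (n + 1) = σ n + (b (n + 1))⁻¹ • (t (n + 1) - t n) := fun n =>
    Finset.sum_range_succ _ n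
  have hσm : Monotone σ := monotone_nat_of_le_succ fun n => by
    rw [hσs]
    exact le_add_of_nonneg_right
      (smul_nonneg (inv_nonneg.2 (hb _).le) (sub_nonneg.2 (ht n.le_succ)))
  have hle : ∀ n, σ n ≤ s := fun n => by
    rw [← sub_nonpos]
    refine hv.2 ?_
    rintro _ ⟨m, rfl⟩
    calc σ n - s ≤ σ (max n m) - s := sub_le_sub_right (hσm (le_max_left _ _)) _
      _ ≤ |σ (max n m) - s| := le_abs_self _
      _ ≤ v (max n m) := hsv _
      _ ≤ v m := hvm (le_max_right _ _)
  refine ⟨hle, ?_, fun l hl => ?_⟩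
  · rintro _ ⟨k, rfl⟩
    exact add_nonneg (smul_nonneg (inv_nonneg.2 (hb _).le) (ht0 k)) (sub_nonneg.2 (hle k))
  -- Telescope `t (l + 1) - t l = b (l + 1) • (σ (l + 1) - σ l)` and replace every weight by the
  -- largest.
  have hkey : ∀ j i, t (j + i) ≤ t j + b (j + i) • (σ (j + i) - σ j) := by
    intro j i
    induction i with
    | zero => simp
    | succ i ih =>
      have h1 : t (j + (i + 1)) = t (j + i) + b (j + i + 1) • (σ (j + i + 1) - σ (j + i)) := by
        rw [hσs, add_sub_cancel_left, smul_inv_smul₀ (hb _).ne', add_sub_cancel, add_assoc]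
      have h2 : b (j + i) • (σ (j + i) - σ j) ≤ b (j + i + 1) • (σ (j + i) - σ j) :=
        smul_le_smul_of_nonneg_right (hbm (Nat.le_succ _))
          (sub_nonneg.2 (hσm (Nat.le_add_right j i)))
      rw [h1]
      calc t (j + i) + b (j + i + 1) • (σ (j + i + 1) - σ (j + i))
          ≤ t j + b (j + i + 1) • (σ (j + i) - σ j) +
            b (j + i + 1) • (σ (j + i + 1) - σ (j + i)) :=
            add_le_add_left (ih.trans (add_le_add_right h2 _)) _
        _ = _ := by rw [← add_assoc j i 1]; module
  -- After division by `b (j + i)`, the term from `t j` becomes arbitrarily small as `i` grows, with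
  -- `j` fixed.
  have hlj : ∀ j, l ≤ s - σ j := fun j => by
    refine le_of_forall_smul_add_le (ht0 j) fun r hr => ?_
    obtain ⟨k, hk, hjk⟩ :=
      ((hblim.eventually_ge_atTop r⁻¹).and (Filter.eventually_ge_atTop j)).exists
    obtain ⟨i, rfl⟩ := Nat.exists_eq_add_of_le hjk
    have h1 : (b (j + i))⁻¹ • t (j + i) ≤ (b (j + i))⁻¹ • t j + (σ (j + i) - σ j) := by
      have := smul_le_smul_of_nonneg_left (hkey j i) (inv_nonneg.2 (hb (j + i)).le)
      rwa [smul_add, inv_smul_smul₀ (hb _).ne'] at this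
    have h2 : (b (j + i))⁻¹ • t j ≤ r • t j :=
      smul_le_smul_of_nonneg_right (inv_le_of_inv_le₀ hr hk) (ht0 j)
    calc l ≤ (b (j + i))⁻¹ • t (j + i) + (s - σ (j + i)) := hl ⟨_, rfl⟩
      _ ≤ r • t j + (σ (j + i) - σ j) + (s - σ (j + i)) :=
        add_le_add_left (h1.trans (add_le_add_left h2 _)) _
      _ = s - σ j + r • t j := by abel
  refine hv.2 ?_
  rintro _ ⟨m, rfl⟩
  refine (hlj m).trans (le_trans ?_ (hsv m))
  rw [abs_sub_comm]
  exact le_abs_self _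

end OrderConvergence

/-! ### Chow's maximal inequality, Jensen's inequality and the upper limit of components. -/

section Maximal

variable {F : Submodule ℝ U} {S : ℕ → F →ₗ[ℝ] F}

theorem IsFiltration.map_map (hS : IsFiltration F S) {i j : ℕ} (hij : i ≤ j) (x : F) :
    S i (S j x) = S i x := by
  rcases hij.eq_or_lt with rfl | h
  · exact (hS.condExp i).projection x
  · exact LinearMap.congr_fun (hS.comp_left i j h) x

/-- A maximal inequality of Chow type for components `B i` with `c • B i ≤ w i • Y i`. -/
theorem IsFiltration.maximal_inequality (hF : ∀ x ∈ F, ∀ v : U, 0 ≤ v → v ≤ x → v ∈ F)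
    (hS : IsFiltration F S) {e : F}
    (hSe : ∀ i, S i e = e) {B : ℕ → F} (hSB : ∀ i, S i (B i) = B i) (hB0 : ∀ i, 0 ≤ B i)
    (hBe : ∀ i, B i ≤ e) (hB : ∀ i, (B i : U) ⊓ (e - B i) = 0) {Y : ℕ → F}
    (hY0 : ∀ i, 0 ≤ Y i) (hY : ∀ i j, i ≤ j → Y i ≤ S i (Y j)) {w : ℕ → ℝ} (hw0 : ∀ i, 0 ≤ w i)
    (hw : Antitone w) {c : ℝ} (hc : 0 < c) (hcB : ∀ i, c • B i ≤ w i • Y i) (m j : ℕ) (H : F)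
    (hH : (H : U) = partialSups (fun i => (B (j + i) : U)) m) :
    c • S j H ≤ S j (w j • Y j +
      ∑ i ∈ Finset.range m, w (j + i + 1) • (Y (j + i + 1) - Y (j + i))) := by
  have hinc : ∀ i j, i ≤ j → S i (Y j) ≤ S i (Y (j + 1)) := fun i j hij => by
    have := (hS.condExp i).mono (hY j (j + 1) j.le_succ)
    rwa [hS.map_map hij] at this
  have hj : ∀ m j, w j • Y j ≤ S j (w j • Y j +
      ∑ i ∈ Finset.range m, w (j + i + 1) • (Y (j + i + 1) - Y (j + i))) := by
    intro m j
    have h1 : (w j • Y j : U) ≤ w j • S j (Y j) :=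
      smul_le_smul_of_nonneg_left (show (Y j : U) ≤ S j (Y j) from hY j j le_rfl) (hw0 j)
    have h2 : (0 : U) ≤ ∑ i ∈ Finset.range m, w (j + i + 1) •
        ((S j (Y (j + i + 1)) : U) - S j (Y (j + i))) :=
      Finset.sum_nonneg fun i _ => smul_nonneg (hw0 _)
        (sub_nonneg.2 (hinc j (j + i) (Nat.le_add_right j i)))
    rw [map_add, map_smul, map_sum]
    change (w j • Y j : U) ≤ (_ + _ : F)
    rw [Submodule.coe_add, Submodule.coe_sum]
    refine h1.trans (le_add_of_nonneg_right (h2.trans_eq ?_))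
    refine Finset.sum_congr rfl fun i _ => ?_
    rw [map_smul, map_sub]
    rfl
  -- The induction lengthens the block at its start: `H` is `B j ⊔ P` with `P` the block from `j +
  -- 1`, so no stopping time is needed.
  induction m generalizing j H with
  | zero =>
    have : H = B j := Subtype.ext (by simpa using hH)
    rw [this, hSB]
    exact (hcB j).trans (hj 0 j)
  | succ m ih =>
    set P := partialSups (fun i => (B (j + 1 + i) : U)) m with hP
    have hP0 : 0 ≤ P := (show (0 : U) ≤ B (j + 1 + 0) from hB0 _).trans
      (le_partialSups_of_le (fun i => (B (j + 1 + i) : U)) m.zero_le)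
    have hPe : P ≤ e := partialSups_le _ _ _ fun i _ => hBe _
    have hHP : (H : U) = (B j : U) ⊔ P := by
      rw [hH]
      refine le_antisymm (partialSups_le _ _ _ fun i hi => ?_)
        (sup_le (le_partialSups_of_le (fun i => (B (j + i) : U)) (m + 1).zero_le)
          (partialSups_le _ _ _ fun i hi => ?_))
      · rcases i with _ | i
        · exact le_sup_left
        · rw [← add_assoc, add_right_comm]
          exact le_sup_of_le_right
            (le_partialSups_of_le (fun i => (B (j + 1 + i) : U)) (Nat.le_of_succ_le_succ hi))
      · rw [add_assoc, add_comm 1 i]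
        exact le_partialSups_of_le (fun i => (B (j + i) : U)) (Nat.succ_le_succ hi)
    have hPF : P ∈ F := hF e e.2 P hP0 hPe
    set K := w j • Y j +
      ∑ i ∈ Finset.range (m + 1), w (j + i + 1) • (Y (j + i + 1) - Y (j + i)) with hK
    set K' := w (j + 1) • Y (j + 1) +
      ∑ i ∈ Finset.range m, w (j + 1 + i + 1) • (Y (j + 1 + i + 1) - Y (j + 1 + i)) with hK'
    -- One step of summation by parts; the extra term is positive since `w` decreases.
    have hKK : K = K' + (w j - w (j + 1)) • Y j := by
      have hsum : ∑ i ∈ Finset.range m, w (j + (i + 1) + 1) • (Y (j + (i + 1) + 1) - Y (j + (i + 1)))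
          = ∑ i ∈ Finset.range m, w (j + 1 + i + 1) • (Y (j + 1 + i + 1) - Y (j + 1 + i)) :=
        Finset.sum_congr rfl fun i _ => by rw [add_assoc j 1 i, add_comm 1 i]
      rw [hK, hK', Finset.sum_range_succ', hsum, add_zero]
      module
    have hK'K : K' ≤ K := by
      have : (0 : U) ≤ (w j - w (j + 1)) • (Y j : U) :=
        smul_nonneg (sub_nonneg.2 (hw j.le_succ)) (hY0 j)
      rw [hKK]
      exact (le_add_of_nonneg_right this : (K' : U) ≤ K' + (w j - w (j + 1)) • (Y j : U))
    have h1 : c • S j ⟨P, hPF⟩ ≤ S j K := by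
      have h := (hS.condExp j).mono (ih (j + 1) ⟨P, hPF⟩ rfl)
      rw [map_smul, hS.map_map j.le_succ, hS.map_map j.le_succ] at h
      exact h.trans ((hS.condExp j).mono hK'K)
    have h2 : c • B j ≤ S j K := (hcB j).trans (hj (m + 1) j)
    have hdiv : ∀ x y : U, c • x ≤ y → x ≤ c⁻¹ • y := fun x y hxy => by
      have := smul_le_smul_of_nonneg_left hxy (inv_nonneg.2 hc.le)
      rwa [inv_smul_smul₀ hc.ne'] at this
    have h3 : (S j H : U) ≤ c⁻¹ • (S j K : U) :=
      ((hS.condExp j).map_sup_le (hSe j) (hSB j) (hB j) (hBe j) (G := ⟨P, hPF⟩) hP0 hPe hHP).trans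
        (sup_le (hdiv _ _ h2) (hdiv _ _ h1))
    have h4 := smul_le_smul_of_nonneg_left h3 hc.le
    rw [smul_inv_smul₀ hc.ne'] at h4
    exact h4

end Maximal

/-- Jensen's inequality for powers given by `p ≥ 1`. -/
theorem IsCondExp.le_map_pow {F : Submodule ℝ U} {S : F →ₗ[ℝ] F} (hS : IsCondExp F S) {e : F}
    (he : 0 ≤ e) (hunit : ∀ y : U, 0 ≤ y → y ⊓ (e : U) = 0 → y = 0) (hSe : S e = e) {p : ℝ}
    (hp : 1 ≤ p) {x y v w : F} (hy : 0 ≤ y) (hxy : x ≤ S y)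
    (hv : IsLUB (lowerSpectralSums (fun t => t ^ p) (e : U) x) v)
    (hw : (w : U) ∈ upperBounds (lowerSpectralSums (fun t => t ^ p) (e : U) y)) : v ≤ S w := by
  have hw0 : 0 ≤ w := hw ⟨0, fun _ => 0, le_rfl, monotone_const, by simp⟩
  -- `S` maps tangents at `y` to tangents at `S y`; the slope is nonnegative, so `S y` may be
  -- replaced by the smaller `x`.
  refine hv.2 (lowerSpectralSums_le_of_tangents he hp (hS.positive w hw0) fun s hs => ?_)
  have hc : 0 ≤ p * s ^ (p - 1) := mul_nonneg (by linarith) (Real.rpow_nonneg hs _)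
  have h1 : s ^ p • e + (p * s ^ (p - 1)) • (y - s • e) ≤ w :=
    tangent_le_of_mem_upperBounds he hunit hy hp hw hs
  have h2 := hS.mono h1
  rw [map_add, map_smul, map_smul, map_sub, map_smul, hSe] at h2
  refine le_trans (add_le_add_right (smul_le_smul_of_nonneg_left ?_ hc) _)
    (show s ^ p • (e : U) + (p * s ^ (p - 1)) • ((S y : U) - s • (e : U)) ≤ S w from h2)
  exact sub_le_sub_right (show (x : U) ≤ S y from hxy) _

/-- If `r ^ p • S₀ (sup_{i ≥ k} B i) ≤ ε k` with `inf ε = 0`, then `limsup B = 0`. -/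
theorem isGLB_iSup_of_condExp {F : Submodule ℝ U} {S : F →ₗ[ℝ] F}
    (hF : ∀ x ∈ F, ∀ v : U, 0 ≤ v → v ≤ x → v ∈ F) (hS : IsCondExp F S)
    (hSpos : IsStrictlyPositiveOp F S) {e : F} {B : ℕ → U} (hB0 : ∀ i, 0 ≤ B i)
    (hBe : ∀ i, B i ≤ e) {ε : ℕ → U} (hε : IsGLB (Set.range ε) 0) {c : ℝ} (hc : 0 < c)
    (h : ∀ k m, ∀ H : F, (H : U) = partialSups (fun i => B (k + i)) m → c • (S H : U) ≤ ε k) :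
    IsGLB (Set.range fun k => ⨆ i, B (k + i)) 0 := by
  have hb : ∀ k, BddAbove (Set.range fun i => B (k + i)) := fun k =>
    ⟨e, by rintro _ ⟨i, rfl⟩; exact hBe _⟩
  have hG0 : ∀ k, 0 ≤ ⨆ i, B (k + i) := fun k => (hB0 (k + 0)).trans (le_ciSup (hb k) 0)
  have hGF : ∀ k, (⨆ i, B (k + i)) ∈ F := fun k =>
    hF e e.2 _ (hG0 k) (ciSup_le fun i => hBe _)
  refine ⟨by rintro _ ⟨k, rfl⟩; exact hG0 k, fun l hl => ?_⟩
  have hlG : ∀ k, l⁺ ≤ ⨆ i, B (k + i) := fun k => sup_le (hl ⟨k, rfl⟩) (hG0 k)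
  have hlF : l⁺ ∈ F := hF _ (hGF 0) _ (posPart_nonneg l) (hlG 0)
  have hPF : ∀ k m, partialSups (fun i => B (k + i)) m ∈ F := fun k m =>
    hF e e.2 _ ((hB0 (k + 0)).trans (le_partialSups_of_le (fun i => B (k + i)) m.zero_le))
      (partialSups_le _ _ _ fun i _ => hBe _)
  have hSG : ∀ k, c • (S ⟨_, hGF k⟩ : U) ≤ ε k := fun k => by
    have hlub : IsLUB (Set.range (partialSups fun i => B (k + i))) (⨆ i, B (k + i)) := by
      have := isLUB_ciSup (hb k)
      rwa [IsLUB, ← upperBounds_range_partialSups] at this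
    have h1 := hS.isLUB_of_monotone hF (u := fun m => ⟨_, hPF k m⟩) (s := ⟨_, hGF k⟩)
      (fun m n hmn => (partialSups fun i => B (k + i)).monotone hmn) hlub
    have h2 : (S ⟨_, hGF k⟩ : U) ≤ c⁻¹ • ε k := h1.2 (by
      rintro _ ⟨m, rfl⟩
      have := smul_le_smul_of_nonneg_left (h k m ⟨_, hPF k m⟩ rfl) (inv_nonneg.2 hc.le)
      rwa [inv_smul_smul₀ hc.ne'] at this)
    have := smul_le_smul_of_nonneg_left h2 hc.le
    rwa [smul_inv_smul₀ hc.ne'] at this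
  -- `l⁺` is below every tail supremum, so its image is below every `ε k`.
  have hSl : c • (S ⟨_, hlF⟩ : U) ≤ 0 := hε.2 (by
    rintro _ ⟨k, rfl⟩
    exact (smul_le_smul_of_nonneg_left (show (S ⟨_, hlF⟩ : U) ≤ S ⟨_, hGF k⟩ from
      hS.mono (hlG k)) hc.le).trans (hSG k))
  have hl0 : (0 : F) ≤ ⟨_, hlF⟩ := posPart_nonneg l
  have hSl' : S ⟨_, hlF⟩ = 0 := by
    refine Subtype.ext (le_antisymm ?_ (hS.positive _ hl0))
    have := smul_le_smul_of_nonneg_left hSl (inv_nonneg.2 hc.le)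
    rwa [inv_smul_smul₀ hc.ne', smul_zero] at this
  have := congrArg Subtype.val (hSpos _ hl0 hSl')
  exact (le_posPart l).trans_eq this

end Module

end RieszSpace

/-! ### The convergence theorem. -/

open RieszSpace
theorem theorem5p1 {U : Type*} [ConditionallyCompleteLattice U] [AddCommGroup U]
    [IsOrderedAddMonoid U] [Module ℝ U] [IsOrderedModule ℝ U]
    (E : Submodule ℝ U) (hE : IsDedekindCompleteRieszSubspace E)
    (hU : IsUniversalCompletion E)
    (e : E) (he : IsWeakOrderUnit E e)
    (T : E →ₗ[ℝ] E) (hT : IsCondExp E T) (hTpos : IsStrictlyPositiveOp E T)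
    (p : ℝ) (hp : 1 ≤ p)
    (S : ℕ → L1 E T →ₗ[ℝ] L1 E T) (X : ℕ → L1 E T)
    (hX : IsSubmartingale (L1 E T) S X)
    (hSpos : IsStrictlyPositiveOp (L1 E T) (S 0))
    (hSe : S 0 ⟨(e : U), mem_L1_of_nonneg T he.1⟩ =
      ⟨(e : U), mem_L1_of_nonneg T he.1⟩)
    (hXnonneg : ∀ i, 0 ≤ X i) (hXp : ∀ i, MemLpT E T (e : U) p (X i : U))
    (a : ℕ → ℝ) (ha : ∀ i, 0 < a i) (hamono : Monotone a)
    (halim : Filter.Tendsto a Filter.atTop Filter.atTop)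
    (hsum : ∃ s : U, OrderTendsto (fun n => ∑ i ∈ Finset.range n,
      (S 0 ((a (i + 1) ^ p)⁻¹ • (absPow (hXp (i + 1)) - absPow (hXp i))) : U)) s) :
    OrderTendsto (fun n => (a n)⁻¹ • (X n : U)) 0 := by

  have hd := hU.orderDense
  have hF : ∀ x ∈ L1 E T, ∀ v : U, 0 ≤ v → v ≤ x → v ∈ L1 E T := fun x hx v hv hvx =>
    L1_solid hE hd hT hx hv hvx
  have hunit : ∀ y : U, 0 ≤ y → y ⊓ (e : U) = 0 → y = 0 := unit_of_orderDense hd he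
  have he0 : (0 : U) ≤ e := he.1
  have hS := hX.filtration
  set e' : L1 E T := ⟨(e : U), mem_L1_of_nonneg T he.1⟩ with he'
  have hSe' : ∀ i, S i e' = e' := fun i => by
    rcases i.eq_zero_or_pos with rfl | hi
    · exact hSe
    · conv_lhs => rw [← hSe]
      exact (LinearMap.congr_fun (hS.comp_right 0 i hi) e').trans hSe
  have hX0 : ∀ i, (0 : U) ≤ X i := hXnonneg
  have hSX : ∀ i, S i (X i) = X i := fun i => by
    obtain ⟨x, hx⟩ := hX.adapted i
    rw [← hx, (hS.condExp i).projection]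
  have hXS : ∀ i j, i ≤ j → X i ≤ S i (X j) := fun i j hij => by
    rcases hij.eq_or_lt with rfl | h
    · exact (hSX i).ge
    · exact hX.le_map i j h
  set Y : ℕ → L1 E T := fun i => absPow (hXp i) with hYdef
  have hYlub : ∀ i, IsLUB (lowerSpectralSums (fun t => t ^ p) (e : U) (X i)) (Y i : U) :=
    fun i => by
      have := (hXp i).isLUB_pow
      rw [hYdef]
      change IsLUB _ (rieszPow (e : U) p |(X i : U)|)
      rwa [abs_of_nonneg (hX0 i)] at this ⊢
  have hY0 : ∀ i, 0 ≤ Y i := fun i =>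
    (hYlub i).1 ⟨0, fun _ => 0, le_rfl, monotone_const, by simp⟩
  have hY : ∀ i j, i ≤ j → Y i ≤ S i (Y j) := fun i j hij =>
    (hS.condExp i).le_map_pow (e := e') he0 hunit (hSe' i) hp (hXnonneg j) (hXS i j hij) (hYlub i)
      (hYlub j).1
  have hb : ∀ i, 0 < a i ^ p := fun i => Real.rpow_pos_of_pos (ha i) p
  have hbm : Monotone fun i => a i ^ p := fun i j hij =>
    Real.rpow_le_rpow (ha i).le (hamono hij) (by linarith)
  have hblim : Filter.Tendsto (fun i => a i ^ p) Filter.atTop Filter.atTop :=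
    (tendsto_rpow_atTop (by linarith)).comp halim
  set t : ℕ → U := fun n => S 0 (Y n) with ht
  have ht0 : ∀ n, 0 ≤ t n := fun n => (hS.condExp 0).positive _ (hY0 n)
  have htm : Monotone t := monotone_nat_of_le_succ fun n => by
    have := (hS.condExp 0).mono (hY n (n + 1) n.le_succ)
    rwa [hS.map_map n.zero_le] at this
  obtain ⟨s, hs⟩ := hsum
  have hs' : OrderTendsto
      (fun n => ∑ i ∈ Finset.range n, (a (i + 1) ^ p)⁻¹ • (t (i + 1) - t i)) s := by
    convert hs using 4 with n i
    rw [map_smul, map_sub]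
    rfl
  obtain ⟨hσs, hε⟩ := isGLB_of_orderTendsto_sum ht0 htm hb hbm hblim hs'
  set y : ℕ → U := fun n => (a n)⁻¹ • (X n : U) with hy
  have hy0 : ∀ n, 0 ≤ y n := fun n => smul_nonneg (inv_nonneg.2 (ha n).le) (hX0 n)
  set B : ℝ → ℕ → U := fun r n => bandComponent (y n - r • (e : U))⁺ e with hB
  have hB0 : ∀ r n, 0 ≤ B r n := fun r n => bandComponent_nonneg _ he0
  have hBe : ∀ r n, B r n ≤ e := fun r n => bandComponent_le _ _
  -- Adaptedness: `B r n` is built from `X n` and `e`, both fixed by `S n`.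
  have hBF : ∀ r n, ∃ h : B r n ∈ L1 E T, S n ⟨B r n, h⟩ = ⟨B r n, h⟩ := fun r n => by
    have hmem : ∀ x : L1 E T, S n x = x →
        (x : U) ∈ (LinearMap.range (S n)).map (L1 E T).subtype := fun x hx =>
      ⟨x, ⟨x, hx⟩, rfl⟩
    refine (mem_range_iff_of_condExp (hS.condExp n)).1 (bandComponent_mem_range hF (hS.condExp n)
      (posPart_nonneg _) he0 ?_ (hmem e' (hSe' n)))
    refine (hS.condExp n).range_complete.sup_mem _ ?_ _ (Submodule.zero_mem _)
    exact Submodule.sub_mem _ (Submodule.smul_mem _ _ (hmem _ (hSX n)))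
      (Submodule.smul_mem _ _ (hmem e' (hSe' n)))
  have hBY : ∀ r, 0 < r → ∀ n, r ^ p • B r n ≤ (a n ^ p)⁻¹ • (Y n : U) := fun r hr n => by
    refine smul_bandComponent_le_of_tangent he0 hp hr.le
      (smul_nonneg (inv_nonneg.2 (hb n).le) (hY0 n)) ?_
    -- The tangent at `r * a n` for `X n`, divided by `a n ^ p`, is the tangent at `r` for `y n`;
    -- the power of `y n` itself is never needed.
    have h := smul_le_smul_of_nonneg_left (tangent_le_of_mem_upperBounds he0 hunit (hX0 n) hp
      (hYlub n).1 (mul_nonneg hr.le (ha n).le)) (inv_nonneg.2 (hb n).le)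
    refine le_trans (le_of_eq ?_) h
    have han := (ha n).ne'
    have h1 : (a n ^ p)⁻¹ * (r * a n) ^ p = r ^ p := by
      rw [Real.mul_rpow hr.le (ha n).le]
      field_simp [(hb n).ne']
    have h2 : (a n ^ p)⁻¹ * (p * (r * a n) ^ (p - 1)) = p * r ^ (p - 1) * (a n)⁻¹ := by
      rw [Real.mul_rpow hr.le (ha n).le, Real.rpow_sub_one han]
      field_simp [(hb n).ne']
    rw [smul_add, smul_smul, smul_smul, h1, h2, mul_smul _ (a n)⁻¹, smul_sub (a n)⁻¹, smul_smul,
      mul_comm r, inv_mul_cancel_left₀ han]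
  have hbdd : ∀ r k, BddAbove (Set.range fun i => B r (k + i)) := fun r k =>
    ⟨e, by rintro _ ⟨i, rfl⟩; exact hBe _ _⟩
  have hGe : ∀ r k, (⨆ i, B r (k + i)) ≤ e := fun r k => ciSup_le fun i => hBe _ _
  have hBG : ∀ r k n, k ≤ n → B r n ≤ ⨆ i, B r (k + i) := fun r k n hkn => by
    obtain ⟨i, rfl⟩ := Nat.exists_eq_add_of_le hkn
    exact le_ciSup (hbdd r k) i
  refine orderTendsto_zero_of_components hU.laterallyComplete he0 hunit hy0
    (G := fun r k => ⨆ i, B r (k + i)) (fun r k l hkl => ciSup_le fun i => hBG r k _ (by omega))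
    (fun r hr => ?_) hGe (fun r k => ?_) (fun r k n hkn => ?_)
  · refine isGLB_iSup_of_condExp hF (hS.condExp 0) hSpos (e := e') (hB0 r) (hBe r) hε
      (Real.rpow_pos_of_pos hr p) fun k m H hH => ?_
    have h1 := hS.maximal_inequality hF hSe' (B := fun n => ⟨B r n, (hBF r n).1⟩)
      (fun n => (hBF r n).2) (hB0 r) (hBe r)
      (fun n => bandComponent_inf_sub (posPart_nonneg _) he0) hY0 hY
      (w := fun n => (a n ^ p)⁻¹) (fun n => inv_nonneg.2 (hb n).le)
      (fun i j hij => inv_anti₀ (hb i) (hbm hij)) (Real.rpow_pos_of_pos hr p) (hBY r hr) m k H hH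
    have h2 := (hS.condExp 0).mono h1
    rw [map_smul, hS.map_map k.zero_le, hS.map_map k.zero_le, map_add, map_smul, map_sum] at h2
    have h3 : r ^ p • (S 0 H : U) ≤ (a k ^ p)⁻¹ • t k + ∑ i ∈ Finset.range m,
        (a (k + i + 1) ^ p)⁻¹ • (t (k + i + 1) - t (k + i)) := by
      refine le_trans (show r ^ p • (S 0 H : U) ≤ _ from h2) (le_of_eq ?_)
      rw [Submodule.coe_add, Submodule.coe_sum]
      congr 1
      refine Finset.sum_congr rfl fun i _ => ?_
      rw [map_smul, map_sub]
      rfl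
    -- The sum is the block of the series from `k` to `k + m`, which is at most the tail beyond `k`.
    refine h3.trans (add_le_add_right (le_sub_iff_add_le'.2 ?_) _)
    have h4 := hσs (k + m)
    rwa [Finset.sum_range_add] at h4
  · have hG0 : 0 ≤ ⨆ i, B r (k + i) := (hB0 r k).trans (hBG r k k le_rfl)
    have hc := sub_nonneg.2 (hGe r k)
    rw [inf_comm]
    refine inf_isLUB_eq_zero (isLUB_ciSup (hbdd r k)) hc hG0 ?_
    rintro _ ⟨i, rfl⟩
    rw [inf_comm]
    exact inf_mono_eq_zero (hB0 r _) hc le_rfl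
      (sub_le_sub_left (hBG r k _ (Nat.le_add_right k i)) _)
      (bandComponent_inf_sub (posPart_nonneg _) he0)
  · exact inf_mono_eq_zero (posPart_nonneg _) (sub_nonneg.2 (hGe r k)) le_rfl
      (sub_le_sub_left (hBG r k n hkn) _) (inf_sub_bandComponent (posPart_nonneg _) he0)
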